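/- Let $d\ge 1$. There is a constant $C>0$, depending only on $d$, such that the following holds. Let $P=\{p_1,\dots,p_n\}$ be a set of $n$ distinct points in $\mathbb{R}^d$. A slab is a region $\{x\in\mathbb{R}^d : a\le\langle w,x\rangle\le b\}$ enclosed between two parallel hyperplanes, with $w\ne 0$ and $a\le b$ arbitrary (different slabs may have different directions and widths). Let $\mathcal{V}\subseteq\{0,1\}^n$ be a set of indicator vectors representing a set system of slabs over $P$, i.e. each $\mathbf{v}\in\mathcal{V}$ is the indicator vector of $\{i : p_i\in S\}$ for some slab $S$, and let $d_0$ be the VC-dimension of $\mathcal{V}$. Let $\delta,k$ be integers with $$1\le\delta\le \frac{n}{2^{d_0+1}},\qquad 1\le k\le n,\qquad k\ge \frac{\delta}{2}.$$ Let $\mathcal{M}(\delta,k,\mathcal{V})$ be the largest cardinality of a subset of $\mathcal{V}$ all of whose vectors have at most $k$ ones and any two distinct members of which differ in more than $\delta$ coordinates. Then $$\mathcal{M}(\delta,k,\mathcal{V})\le C\,\frac{n^d k}{\delta^{d+1}} .$$ -/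

import Mathlib

namespace ShallowPacking

/-- The distance of two subsets of the index set `Fin n`, i.e. the `L¹` (Hamming) distance of
their indicator vectors: the size of the symmetric difference. -/
def rho {n : ℕ} (u v : Finset (Fin n)) : ℕ := (symmDiff u v).card

/-- A family of sets (indicator vectors) is `δ`-separated if any two distinct members are at
distance greater than `δ`. -/
def IsDeltaSeparated {n : ℕ} (δ : ℕ) (W : Finset (Finset (Fin n))) : Prop :=
  ∀ u ∈ W, ∀ v ∈ W, u ≠ v → δ < rho u v

open Classical in
/-- The `δ`-packing number: the largest cardinality of a `δ`-separated subfamily. -/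
noncomputable def packingNumber {n : ℕ} (δ : ℕ) (V : Finset (Finset (Fin n))) : ℕ :=
  (V.powerset.filter (fun W => IsDeltaSeparated δ W)).sup Finset.card

/-- The `k`-shallow `δ`-packing number: the `δ`-packing number of the members of `V` that have
size at most `k` (all of `V` when `V` itself is `k`-shallow). -/
noncomputable def shallowPackingNumber {n : ℕ} (δ k : ℕ) (V : Finset (Finset (Fin n))) : ℕ :=
  packingNumber δ (V.filter (fun v => v.card ≤ k))

/-- A slab in `ℝ^d`: the closed region enclosed between two parallel hyperplanes, of arbitrary
direction and arbitrary width. -/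
def IsSlab {d : ℕ} (S : Set (EuclideanSpace ℝ (Fin d))) : Prop :=
  ∃ (w : EuclideanSpace ℝ (Fin d)) (a b : ℝ), w ≠ 0 ∧ a ≤ b ∧
    S = {x | a ≤ inner ℝ w x ∧ inner ℝ w x ≤ b}

/-- `V` represents a set system of slabs over the points `p 0, …, p (n - 1)`: each member
of `V` is the set of indices of the points that lie in some slab. -/
def IsSlabSystem {d n : ℕ} (p : Fin n → EuclideanSpace ℝ (Fin d))
    (V : Finset (Finset (Fin n))) : Prop :=
  ∀ v ∈ V, ∃ S : Set (EuclideanSpace ℝ (Fin d)), IsSlab S ∧ ∀ i, i ∈ v ↔ p i ∈ S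

end ShallowPacking

/-!
The theorem rests on the shallow shatter function of slabs: slabs cut at most `O(m ^ d * r)` sets of
size at most `r` out of `m` points of `ℝ ^ d` (`exists_card_traces_le`). A sampling argument then
turns this into a packing bound.

*Shatter function.* Rescale a slab to width one, `0 ≤ ⟪w, q⟫ - a ≤ 1`. Each point `q` becomes a
linear functional on the space `W` of the parameters `(w, a)`, of dimension `D = d + 1`, and a slab
becomes a point of `W`, lying below, between or above the two walls `x = 0` and `x = 1` of each
functional `x`. So one has to show that the arrangement of these `m` pairs of parallel hyperplanes
in `W`, one of each pair through the origin, has only `O(m ^ (D - 1) * r)` cells between at most `r`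
pairs. After a perturbation into general position (`exists_genPos_near`) cells are charged to their
vertices (`GenPos.card_cells_mids_le`), and the vertices between at most `r` pairs are reduced to
the vertices between no pair by random sampling, after Clarkson and Shor
(`exists_vertexCount_le`).

That there are only `O(m ^ (D - 1))` vertices between no pair of walls is a form of the zone theorem
(`exists_vertexCount_zero_le`), by induction on `D`. Faces of codimension `k ≤ D - 2` are counted
by deleting one functional `q` at a time: by convexity, a face that `q` cuts in two leaves a face of
the arrangement induced on the central wall of `q`, in dimension `D - 1` (`card_cells_off_le`,
`GenPos.faceCount_le_choose`). With respect to a generic linear functional each vertex is the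
unique lowest or highest vertex of a face of codimension at most `D / 2`
(`GenPos.vertexCount_zero_le`), and `D / 2 ≤ D - 2` for `D ≥ 3`. The plane is treated directly, as a
lower envelope of affine functions on a line (`card_breakpoints_le`).

*Packing.* The VC dimension is bounded in terms of `d`, since the shatter function is polynomial
(`exists_vcBound`). Haussler's argument, through the density of unit distance graphs, shows that a
random sample of rate proportional to `1 / δ` distinguishes most members of a `δ`-separated family
(`separated_sub_sampleMean_le`). Most members have a trace of size `O(k / δ)` on the sample, which
has about `n / δ` points, and the shatter function bounds the number of such traces.
-/

namespace ShallowPacking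
open Finset Module

/-! ### Walls and cells -/

section Cells
variable {ι W : Type} [AddCommGroup W] [Module ℝ W]

/-- The position of a real number relative to the two walls `0` and `1`. -/
noncomputable def wallSign (t : ℝ) : SignType × SignType :=
  (SignType.sign t, SignType.sign (t - 1))

open Classical in
/-- The position vector of `w` relative to the walls `x i = 0` and `x i = 1`, `i ∈ X`. Indices
outside `X` get the value `(0, 0)`, which no real number has. -/
noncomputable def cell (x : ι → Dual ℝ W) (X : Finset ι) (w : W) : ι → SignType × SignType :=
  fun i => if i ∈ X then wallSign (x i w) else 0

open Classical in
/-- The indices in `X` one of whose two walls passes through `w`. -/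
noncomputable def tight (x : ι → Dual ℝ W) (X : Finset ι) (w : W) : Finset ι :=
  {i ∈ X | x i w = 0 ∨ x i w = 1}

open Classical in
/-- The indices in `X` between whose two walls `w` lies strictly. -/
noncomputable def mids (x : ι → Dual ℝ W) (X : Finset ι) (w : W) : Finset ι :=
  {i ∈ X | 0 < x i w ∧ x i w < 1}

open Classical in
/-- General position of the walls: away from the origin, fewer than `dim W` of the central
walls `x i = 0` meet, and at most `dim W` of all the walls. -/
def GenPos (x : ι → Dual ℝ W) (X : Finset ι) : Prop :=
  ∀ w : W, w ≠ 0 → #{i ∈ X | x i w = 0} < finrank ℝ W ∧ #(tight x X w) ≤ finrank ℝ W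

open Classical in
/-- The position vectors of the points satisfying `P`. -/
noncomputable def cells [Fintype ι] (x : ι → Dual ℝ W) (X : Finset ι) (P : W → Prop) :
    Finset (ι → SignType × SignType) :=
  {σ | ∃ w, P w ∧ cell x X w = σ}

/-- The number of codimension-`k` faces of the cells that lie between no pair of walls. -/
noncomputable def faceCount [Fintype ι] (x : ι → Dual ℝ W) (X : Finset ι) (k : ℕ) : ℕ :=
  #(cells x X fun w => #(tight x X w) = k ∧ mids x X w = ∅)

/-- The number of vertices other than the origin that lie strictly between at most `r` pairs
of walls. -/
noncomputable def vertexCount [Fintype ι] (x : ι → Dual ℝ W) (X : Finset ι) (r : ℕ) : ℕ :=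
  #(cells x X fun w => w ≠ 0 ∧ #(tight x X w) = finrank ℝ W ∧ #(mids x X w) ≤ r)

lemma mem_tight {x : ι → Dual ℝ W} {X : Finset ι} {w : W} {i : ι} :
    i ∈ tight x X w ↔ i ∈ X ∧ (x i w = 0 ∨ x i w = 1) := by
  classical
  simp [tight]

lemma mem_mids {x : ι → Dual ℝ W} {X : Finset ι} {w : W} {i : ι} :
    i ∈ mids x X w ↔ i ∈ X ∧ 0 < x i w ∧ x i w < 1 := by
  classical
  simp [mids]

lemma mem_cells [Fintype ι] {x : ι → Dual ℝ W} {X : Finset ι} {P : W → Prop}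
    {σ : ι → SignType × SignType} : σ ∈ cells x X P ↔ ∃ w, P w ∧ cell x X w = σ := by
  classical
  simp [cells]

lemma wallSign_eq_iff {s t : ℝ} :
    wallSign s = wallSign t ↔ (s < 0 ↔ t < 0) ∧ (s = 0 ↔ t = 0) ∧ (s = 1 ↔ t = 1) ∧
      (1 < s ↔ 1 < t) := by
  simp only [wallSign, Prod.mk.injEq]
  constructor
  · rintro ⟨h1, h2⟩
    refine ⟨?_, ?_, ?_, ?_⟩
    · rw [← sign_eq_neg_one_iff, h1, sign_eq_neg_one_iff]
    · rw [← sign_eq_zero_iff, h1, sign_eq_zero_iff]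
    · rw [← sub_eq_zero, ← sign_eq_zero_iff, h2, sign_eq_zero_iff, sub_eq_zero]
    · rw [← sub_pos, ← sign_eq_one_iff, h2, sign_eq_one_iff, sub_pos]
  · rintro ⟨h1, h2, h3, h4⟩
    constructor
    · rcases lt_trichotomy s 0 with h | h | h
      · rw [sign_neg h, sign_neg (h1.1 h)]
      · rw [h, h2.1 h]
      · have : 0 < t := by
          rcases lt_trichotomy t 0 with h' | h' | h'
          · exact absurd (h1.2 h') (by linarith)
          · exact absurd (h2.2 h') (by linarith)
          · exact h'
        rw [sign_pos h, sign_pos this]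
    · rcases lt_trichotomy s 1 with h | h | h
      · have : t < 1 := by
          rcases lt_trichotomy t 1 with h' | h' | h'
          · exact h'
          · exact absurd (h3.2 h') (by linarith)
          · exact absurd (h4.2 h') (by linarith)
        rw [sign_neg (by linarith), sign_neg (by linarith)]
      · rw [h, h3.1 h]
      · rw [sign_pos (by linarith), sign_pos (by linarith [h4.1 h])]

lemma cell_eq_iff {V : Type} [AddCommGroup V] [Module ℝ V] {x : ι → Dual ℝ W}
    {y : ι → Dual ℝ V} {X : Finset ι} {w : W} {v : V} :
    cell x X w = cell y X v ↔ ∀ i ∈ X, wallSign (x i w) = wallSign (y i v) := by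
  classical
  simp only [cell, funext_iff]
  refine forall_congr' fun i => ?_
  by_cases h : i ∈ X <;> simp [h]

lemma tight_congr {V : Type} [AddCommGroup V] [Module ℝ V] {x : ι → Dual ℝ W}
    {y : ι → Dual ℝ V} {X : Finset ι} {w : W} {v : V} (h : cell x X w = cell y X v) :
    tight x X w = tight y X v := by
  ext i
  simp only [mem_tight]
  refine and_congr_right fun hi => ?_
  obtain ⟨-, h2, h3, -⟩ := wallSign_eq_iff.1 (cell_eq_iff.1 h i hi)
  rw [h2, h3]

lemma mids_congr {V : Type} [AddCommGroup V] [Module ℝ V] {x : ι → Dual ℝ W}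
    {y : ι → Dual ℝ V} {X : Finset ι} {w : W} {v : V} (h : cell x X w = cell y X v) :
    mids x X w = mids y X v := by
  ext i
  simp only [mem_mids]
  refine and_congr_right fun hi => ?_
  obtain ⟨h1, h2, h3, h4⟩ := wallSign_eq_iff.1 (cell_eq_iff.1 h i hi)
  grind

/-- Position vectors are counted by any invariant that determines them. -/
lemma card_cells_le [Fintype ι] {x : ι → Dual ℝ W} {X : Finset ι} {P : W → Prop} {β : Type*}
    (f : W → β) (B : Finset β) (hB : ∀ w, P w → f w ∈ B)
    (hf : ∀ w w', P w → P w' → f w = f w' → cell x X w = cell x X w') :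
    #(cells x X P) ≤ #B := by
  classical
  have hc : ∀ σ ∈ cells x X P, ∃ w, P w ∧ cell x X w = σ := fun σ h => mem_cells.1 h
  choose! g hg using hc
  refine card_le_card_of_injOn (fun σ => f (g σ)) (fun σ h => hB _ (hg σ h).1) ?_
  intro σ hσ τ hτ h
  rw [← (hg σ hσ).2, ← (hg τ hτ).2]
  exact hf _ _ (hg σ hσ).1 (hg τ hτ).1 h

lemma card_cells_mono [Fintype ι] {x : ι → Dual ℝ W} {X : Finset ι} {P Q : W → Prop}
    (h : ∀ w, P w → Q w) : #(cells x X P) ≤ #(cells x X Q) :=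
  card_le_card fun _ hσ => by
    obtain ⟨w, hw, e⟩ := mem_cells.1 hσ
    exact mem_cells.2 ⟨w, h w hw, e⟩

lemma card_cells_or [Fintype ι] {x : ι → Dual ℝ W} {X : Finset ι} (P Q : W → Prop) :
    #(cells x X fun w => P w ∨ Q w) ≤ #(cells x X P) + #(cells x X Q) := by
  classical
  refine (card_le_card fun σ hσ => ?_).trans (card_union_le _ _)
  obtain ⟨w, hw, e⟩ := mem_cells.1 hσ
  rcases hw with h | h
  · exact mem_union_left _ (mem_cells.2 ⟨w, h, e⟩)
  · exact mem_union_right _ (mem_cells.2 ⟨w, h, e⟩)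

lemma card_cells_le_pow [Fintype ι] (x : ι → Dual ℝ W) (X : Finset ι) (P : W → Prop) :
    #(cells x X P) ≤ 9 ^ #X := by
  classical
  refine (card_cells_le (fun w (i : X) => wallSign (x i w)) univ (fun _ _ => mem_univ _)
    fun w w' _ _ h => cell_eq_iff.2 fun i hi => congrFun h ⟨i, hi⟩).trans ?_
  simp
  exact le_of_eq (by congr 1)

lemma GenPos.subset {x : ι → Dual ℝ W} {X Y : Finset ι} (h : GenPos x X) (hY : Y ⊆ X) :
    GenPos x Y := by
  classical
  intro w hw
  refine ⟨(card_le_card (filter_subset_filter _ hY)).trans_lt (h w hw).1,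
    (card_le_card ?_).trans (h w hw).2⟩
  exact filter_subset_filter _ hY

/-- Two points at which `dim W` of the functionals agree are equal. -/
lemma GenPos.eq_of_eqOn {x : ι → Dual ℝ W} {X T : Finset ι} (h : GenPos x X) (hT : T ⊆ X)
    (hc : finrank ℝ W ≤ #T) {v w : W} (he : ∀ t ∈ T, x t v = x t w) : v = w := by
  classical
  by_contra hne
  have := (h (v - w) (sub_ne_zero.2 hne)).1
  have h2 : T ⊆ X.filter (fun i => x i (v - w) = 0) := fun t ht => by
    simp [hT ht, he t ht]
  exact absurd (hc.trans (card_le_card h2)) (by omega)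

/-- `dim W` of the functionals take arbitrary values simultaneously. -/
lemma GenPos.exists_apply_eq [FiniteDimensional ℝ W] {x : ι → Dual ℝ W} {X T : Finset ι}
    (h : GenPos x X) (hT : T ⊆ X) (hc : #T = finrank ℝ W) (c : ι → ℝ) :
    ∃ w, ∀ t ∈ T, x t w = c t := by
  let f : W →ₗ[ℝ] (T → ℝ) := LinearMap.pi fun t => x t
  have hinj : Function.Injective f := fun v w hvw =>
    h.eq_of_eqOn hT hc.ge fun t ht => congrFun hvw ⟨t, ht⟩
  have hs : Function.Surjective f :=
    (LinearMap.injective_iff_surjective_of_finrank_eq_finrank (by simp [hc])).1 hinj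
  obtain ⟨w, hw⟩ := hs fun t => c t
  exact ⟨w, fun t ht => congrFun hw ⟨t, ht⟩⟩

/-- Fewer than `dim W` functionals have a common nontrivial zero. -/
lemma exists_ne_zero_of_card_lt [FiniteDimensional ℝ W] (x : ι → Dual ℝ W) (T : Finset ι)
    (hc : #T < finrank ℝ W) : ∃ w, w ≠ 0 ∧ ∀ t ∈ T, x t w = 0 := by
  let f : W →ₗ[ℝ] (T → ℝ) := LinearMap.pi fun t => x t
  have : ∃ w ∈ LinearMap.ker f, w ≠ 0 := by
    apply Submodule.exists_mem_ne_zero_of_ne_bot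
    exact LinearMap.ker_ne_bot_of_finrank_lt (by simpa using hc)
  obtain ⟨w, hw, h0⟩ := this
  exact ⟨w, h0, fun t ht => congrFun (LinearMap.mem_ker.1 hw) ⟨t, ht⟩⟩

lemma GenPos.apply_ne_zero [FiniteDimensional ℝ W] {x : ι → Dual ℝ W} {X : Finset ι}
    (h : GenPos x X) (hX : finrank ℝ W ≤ #X) (hD : 0 < finrank ℝ W) {q : ι} (hq : q ∈ X) :
    x q ≠ 0 := by
  classical
  intro h0
  obtain ⟨T, hT, hTc⟩ := exists_subset_card_eq
    (show finrank ℝ W - 1 ≤ #(X.erase q) by rw [card_erase_of_mem hq]; omega)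
  obtain ⟨w, hw, hz⟩ := exists_ne_zero_of_card_lt x T (by omega)
  have := (h w hw).1
  have hsub : insert q T ⊆ X.filter (fun i => x i w = 0) := by
    intro i hi
    rcases mem_insert.1 hi with rfl | hi
    · simp [hq, h0]
    · simp [hz i hi, mem_of_mem_erase (hT hi)]
  have hqT : q ∉ T := fun hh => by simpa using hT hh
  have := card_le_card hsub
  rw [card_insert_of_notMem hqT] at this
  omega

/-- The functionals restricted to the central wall of `q`. -/
def restrictWall (x : ι → Dual ℝ W) (q : ι) : ι → Dual ℝ (LinearMap.ker (x q)) :=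
  fun i => (x i).domRestrict (LinearMap.ker (x q))

lemma finrank_ker_add_one [FiniteDimensional ℝ W] {f : Dual ℝ W} (hf : f ≠ 0) :
    finrank ℝ (LinearMap.ker f) + 1 = finrank ℝ W :=
  Module.Dual.finrank_ker_add_one_of_ne_zero hf

lemma GenPos.restrict_ker [FiniteDimensional ℝ W] [DecidableEq ι] {x : ι → Dual ℝ W}
    {X : Finset ι} (h : GenPos x X) {q : ι} (hq : q ∈ X) (h0 : x q ≠ 0) :
    GenPos (restrictWall x q) (X.erase q) := by
  classical
  intro w hw
  have hw' : (w : W) ≠ 0 := fun e => hw (Subtype.ext e)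
  obtain ⟨h1, h2⟩ := h w hw'
  have hd := finrank_ker_add_one h0
  have hwq : x q w = 0 := w.2
  constructor
  · have : X.filter (fun i => x i w = 0)
      = insert q ((X.erase q).filter (fun i => restrictWall x q i w = 0)) := by
      ext i
      by_cases hi : i = q
      · subst hi; simp [hq, hwq]
      · rw [mem_insert, mem_filter, mem_filter, mem_erase]
        simp [hi, restrictWall]
    rw [this, card_insert_of_notMem (by simp)] at h1
    omega
  · have : tight x X w = insert q (tight (restrictWall x q) (X.erase q) w) := by
      ext i
      by_cases hi : i = q
      · subst hi; simp [hq, hwq, mem_tight]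
      · simp [hi, restrictWall, mem_tight]
    rw [this, card_insert_of_notMem (by simp [mem_tight])] at h2
    omega

end Cells

/-! ### Deleting a functional -/

section Deletion
variable {ι W : Type} [AddCommGroup W] [Module ℝ W]

lemma wallSign_segment {a b t : ℝ} (h : wallSign a = wallSign b) (ht : 0 ≤ t) (ht1 : t ≤ 1) :
    wallSign ((1 - t) * a + t * b) = wallSign a := by
  obtain ⟨h1, h2, h3, h4⟩ := wallSign_eq_iff.1 h
  have key : ∀ c : ℝ, (a < c ↔ b < c) → (a = c ↔ b = c) →
      ((1 - t) * a + t * b < c ↔ a < c) ∧ ((1 - t) * a + t * b = c ↔ a = c) := by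
    intro c hlt heq
    rcases lt_trichotomy a c with hc | hc | hc
    · have hb := hlt.1 hc
      have : (1 - t) * a + t * b < c := by
        rcases ht.eq_or_lt with rfl | ht
        · simpa using hc
        · nlinarith [mul_pos ht (sub_pos.2 hb), mul_nonneg (sub_nonneg.2 ht1) (sub_pos.2 hc).le]
      exact ⟨iff_of_true this hc, iff_of_false this.ne hc.ne⟩
    · have hb := heq.1 hc
      have : (1 - t) * a + t * b = c := by rw [hc, hb]; ring
      exact ⟨iff_of_false this.not_lt hc.not_lt, iff_of_true this hc⟩
    · have hb : c < b := lt_of_le_of_ne (not_lt.1 fun hh => hc.not_gt (hlt.2 hh))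
        fun hh => hc.ne' (heq.2 hh.symm)
      have : c < (1 - t) * a + t * b := by
        rcases ht.eq_or_lt with rfl | ht
        · simpa using hc
        · nlinarith [mul_pos ht (sub_pos.2 hb), mul_nonneg (sub_nonneg.2 ht1) (sub_pos.2 hc).le]
      exact ⟨iff_of_false this.not_gt hc.not_gt, iff_of_false this.ne' hc.ne'⟩
  have h5 : a < 1 ↔ b < 1 := by grind
  obtain ⟨k1, k2⟩ := key 0 h1 h2
  obtain ⟨k3, k4⟩ := key 1 h5 h3
  refine wallSign_eq_iff.2 ⟨k1, k2, k4, ?_⟩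
  grind

/-- Deleting a functional `q`: a face of the remaining arrangement that `q` splits into a part
below and a part above meets the central wall of `q`, because faces are convex. -/
lemma card_cells_off_le [Fintype ι] [DecidableEq ι] (x : ι → Dual ℝ W) {X : Finset ι} {q : ι}
    (hq : q ∈ X) (k : ℕ) :
    #(cells x X fun w => (#(tight x X w) = k ∧ mids x X w = ∅) ∧ q ∉ tight x X w) ≤
      faceCount x (X.erase q) k + faceCount (restrictWall x q) (X.erase q) k := by
  classical
  set Y := X.erase q with hY
  have hXY : insert q Y = X := insert_erase hq
  -- A face with `q` off its walls is determined by its trace on `Y` and the side of `q`.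
  let N := cells x Y fun w => (#(tight x Y w) = k ∧ mids x Y w = ∅) ∧ x q w < 0
  let B := cells x Y fun w => (#(tight x Y w) = k ∧ mids x Y w = ∅) ∧ 1 < x q w
  have hoff : ∀ w, (#(tight x X w) = k ∧ mids x X w = ∅) ∧ q ∉ tight x X w →
      (#(tight x Y w) = k ∧ mids x Y w = ∅) ∧ (x q w < 0 ∨ 1 < x q w) := by
    rintro w ⟨⟨h1, h2⟩, h3⟩
    have e : tight x X w = tight x Y w := by
      ext i
      rw [mem_tight, mem_tight, hY, mem_erase]
      by_cases hi : i = q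
      · subst hi
        have : ¬ (x i w = 0 ∨ x i w = 1) := fun hh => h3 (mem_tight.2 ⟨hq, hh⟩)
        simp [this]
      · simp [hi]
    refine ⟨⟨e ▸ h1, ?_⟩, ?_⟩
    · refine eq_empty_of_forall_notMem fun i hi => ?_
      rw [mem_mids] at hi
      have : i ∈ mids x X w := mem_mids.2 ⟨mem_of_mem_erase hi.1, hi.2⟩
      simp [h2] at this
    · have h4 : q ∉ mids x X w := by simp [h2]
      rw [mem_mids] at h4
      rw [mem_tight] at h3
      grind
  have hle : #(cells x X fun w => (#(tight x X w) = k ∧ mids x X w = ∅) ∧ q ∉ tight x X w) ≤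
      #N + #B := by
    refine (card_cells_mono (Q := fun w =>
      ((#(tight x Y w) = k ∧ mids x Y w = ∅) ∧ x q w < 0) ∨
      ((#(tight x Y w) = k ∧ mids x Y w = ∅) ∧ 1 < x q w)) fun w hw => ?_).trans
      ((card_cells_or _ _).trans (add_le_add ?_ ?_))
    · have := hoff w hw
      tauto
    · refine card_cells_le (fun w => cell x Y w) N (fun w hw => mem_cells.2 ⟨w, hw, rfl⟩) ?_
      intro w w' hw hw' he
      rw [cell_eq_iff, ← hXY]
      intro i hi
      rcases mem_insert.1 hi with rfl | hi
      · have h1 := hw.2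
        have h2 := hw'.2
        rw [wallSign_eq_iff]
        grind
      · exact cell_eq_iff.1 he i hi
    · refine card_cells_le (fun w => cell x Y w) B (fun w hw => mem_cells.2 ⟨w, hw, rfl⟩) ?_
      intro w w' hw hw' he
      rw [cell_eq_iff, ← hXY]
      intro i hi
      rcases mem_insert.1 hi with rfl | hi
      · have h1 := hw.2
        have h2 := hw'.2
        rw [wallSign_eq_iff]
        grind
      · exact cell_eq_iff.1 he i hi
  have hun : #(N ∪ B) ≤ faceCount x Y k := by
    refine card_le_card fun σ hσ => ?_
    rcases mem_union.1 hσ with h | h <;> obtain ⟨w, hw, e⟩ := mem_cells.1 h <;>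
      exact mem_cells.2 ⟨w, hw.1, e⟩
  have hin : #(N ∩ B) ≤ faceCount (restrictWall x q) Y k := by
    refine card_le_card fun σ hσ => ?_
    obtain ⟨h1, h2⟩ := mem_inter.1 hσ
    obtain ⟨v, ⟨hv, hvq⟩, ev⟩ := mem_cells.1 h1
    obtain ⟨w, ⟨hw, hwq⟩, ew⟩ := mem_cells.1 h2
    have hden : 0 < x q w - x q v := by linarith
    let t : ℝ := -x q v / (x q w - x q v)
    have ht0 : 0 ≤ t := div_nonneg (by linarith) hden.le
    have ht1 : t ≤ 1 := (div_le_one hden).2 (by linarith)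
    let u : W := (1 - t) • v + t • w
    have hu : x q u = 0 := by
      simp only [u, map_add, map_smul, smul_eq_mul, t]
      field_simp
      ring
    have hcell : cell (restrictWall x q) Y ⟨u, hu⟩ = cell x Y v := by
      rw [cell_eq_iff]
      intro i hi
      have hs := cell_eq_iff.1 (ev.trans ew.symm) i hi
      rw [← wallSign_segment hs ht0 ht1]
      simp [restrictWall, u]
    refine mem_cells.2 ⟨⟨u, hu⟩, ⟨?_, ?_⟩, hcell.trans ev⟩
    · rw [tight_congr hcell]; exact hv.1
    · rw [mids_congr hcell]; exact hv.2
  calc _ ≤ #N + #B := hle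
    _ = #(N ∪ B) + #(N ∩ B) := (card_union_add_card_inter _ _).symm
    _ ≤ _ := add_le_add hun hin

/-- Summing the deletion of `q` over all `q`: a face is counted once for each of the functionals
that it is not on a wall of. -/
lemma sub_mul_faceCount_le [Fintype ι] [DecidableEq ι] (x : ι → Dual ℝ W) (X : Finset ι) (k : ℕ) :
    (#X - k) * faceCount x X k ≤
      ∑ q ∈ X, (faceCount x (X.erase q) k + faceCount (restrictWall x q) (X.erase q) k) := by
  classical
  refine le_trans ?_ (sum_le_sum fun q hq => card_cells_off_le x hq k)
  have hsub : ∀ q, (cells x X fun w => (#(tight x X w) = k ∧ mids x X w = ∅) ∧ q ∉ tight x X w) ⊆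
      cells x X fun w => #(tight x X w) = k ∧ mids x X w = ∅ := fun q σ hσ => by
    obtain ⟨w, hw, e⟩ := mem_cells.1 hσ
    exact mem_cells.2 ⟨w, hw.1, e⟩
  set F := cells x X fun w => #(tight x X w) = k ∧ mids x X w = ∅ with hF
  have e1 : ∀ q, #(cells x X fun w => (#(tight x X w) = k ∧ mids x X w = ∅) ∧ q ∉ tight x X w) =
      ∑ σ ∈ F, if σ ∈ (cells x X fun w => (#(tight x X w) = k ∧ mids x X w = ∅) ∧
        q ∉ tight x X w) then 1 else 0 := by
    intro q
    rw [← card_filter, filter_mem_eq_inter, inter_eq_right.2 (hsub q)]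
  simp_rw [e1]
  rw [sum_comm, mul_comm]
  refine card_nsmul_le_sum F _ _ fun σ hσ => ?_
  obtain ⟨w, hw, rfl⟩ := mem_cells.1 hσ
  rw [← card_filter]
  calc #X - k = #(X \ tight x X w) := by
        rw [card_sdiff_of_subset (fun i hi => (mem_tight.1 hi).1), hw.1]
    _ ≤ _ := card_le_card fun i hi => by
        rw [mem_sdiff] at hi
        exact mem_filter.2 ⟨hi.1, mem_cells.2 ⟨w, ⟨hw, hi.2⟩, rfl⟩⟩

end Deletion

/-! ### Vertices of cells -/

section Vertices
variable {ι W : Type} [AddCommGroup W] [Module ℝ W]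

/-- `v` lies in the closure of the cell of `w`. -/
def InClosure (x : ι → Dual ℝ W) (X : Finset ι) (w v : W) : Prop :=
  ∀ i ∈ X, (x i w ≤ 0 → x i v ≤ 0) ∧ (0 ≤ x i w → 0 ≤ x i v) ∧ (x i w ≤ 1 → x i v ≤ 1) ∧
    (1 ≤ x i w → 1 ≤ x i v)

lemma InClosure.trans {x : ι → Dual ℝ W} {X : Finset ι} {u v w : W} (h : InClosure x X u v)
    (h' : InClosure x X v w) : InClosure x X u w := fun i hi => by
  obtain ⟨a, b, c, d⟩ := h i hi
  obtain ⟨a', b', c', d'⟩ := h' i hi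
  tauto

/-- A point on fewer than `dim W` walls can be moved inside its cell, staying on these walls,
until it hits a further wall. -/
lemma GenPos.exists_tight_lt [FiniteDimensional ℝ W] {x : ι → Dual ℝ W} {X : Finset ι}
    (h : GenPos x X) (hX : finrank ℝ W ≤ #X) {w : W} (hw : #(tight x X w) < finrank ℝ W) :
    ∃ v, InClosure x X w v ∧ #(tight x X w) < #(tight x X v) := by
  classical
  have hu : ∃ u : W, (∀ i ∈ tight x X w, x i u = 0) ∧
      ∃ j ∈ X, ∃ c : ℝ, (c = 0 ∨ c = 1) ∧ x j u ≠ 0 ∧ 0 < (c - x j w) / x j u := by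
    obtain ⟨u, hu0, hu⟩ := exists_ne_zero_of_card_lt x _ hw
    obtain ⟨j, hj, hju⟩ : ∃ j ∈ X, x j u ≠ 0 := by
      by_contra! hh
      have := (h u hu0).1
      rw [filter_true_of_mem hh] at this
      omega
    have hjw : x j w ≠ 0 := fun e => hju (hu j (mem_tight.2 ⟨hj, Or.inl e⟩))
    have hq : (0 - x j w) / x j u ≠ 0 := by simp [hjw, hju]
    rcases lt_or_gt_of_ne hq with hneg | hpos
    · refine ⟨-u, fun i hi => by simp [hu i hi], j, hj, 0, Or.inl rfl, by simpa using hju, ?_⟩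
      rw [map_neg, div_neg]
      linarith
    · exact ⟨u, hu, j, hj, 0, Or.inl rfl, hju, hpos⟩
  obtain ⟨u, hu, j, hj, c, hc, hju, hpos⟩ := hu
  -- The times at which the ray from `w` in direction `u` crosses a wall.
  let H : Finset ℝ := ((X ×ˢ {(0 : ℝ), 1}).image
    fun p : ι × ℝ => (p.2 - x p.1 w) / x p.1 u).filter (0 < ·)
  have hH : H.Nonempty := ⟨_, mem_filter.2 ⟨mem_image.2 ⟨(j, c), by simp [hj, hc], rfl⟩, hpos⟩⟩
  obtain ⟨ht, hmin⟩ : H.min' hH ∈ H ∧ ∀ t ∈ H, H.min' hH ≤ t :=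
    ⟨H.min'_mem hH, fun t ht => H.min'_le t ht⟩
  set t := H.min' hH
  obtain ⟨ht1, htpos⟩ := mem_filter.1 ht
  obtain ⟨⟨k, e⟩, hk, hke⟩ := mem_image.1 ht1
  have hk' : k ∈ X ∧ (e = 0 ∨ e = 1) := by simpa using hk
  have hku : x k u ≠ 0 := by
    rintro h0
    simp only [h0, div_zero] at hke
    exact htpos.ne hke
  have hval : ∀ i, x i (w + t • u) = x i w + t * x i u := fun i => by simp
  have hcross : ∀ i ∈ X, ∀ c : ℝ, (c = 0 ∨ c = 1) →
      (x i w ≤ c → x i (w + t • u) ≤ c) ∧ (c ≤ x i w → c ≤ x i (w + t • u)) := by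
    intro i hi c hc
    have htime : x i u ≠ 0 → 0 < (c - x i w) / x i u → t ≤ (c - x i w) / x i u := fun _ h1 =>
      hmin _ (mem_filter.2 ⟨mem_image.2 ⟨(i, c), by simp [hi, hc], rfl⟩, h1⟩)
    rw [hval]
    rcases eq_or_ne (x i w) c with heq | hne
    · have : x i u = 0 := hu i (mem_tight.2 ⟨hi, heq ▸ hc⟩)
      simp [this, heq]
    · constructor
      · intro hle
        by_contra! hlt
        have hlt' : x i w < c := lt_of_le_of_ne hle hne
        have hup : 0 < x i u := by
          by_contra! hh
          nlinarith
        have := htime hup.ne' (div_pos (by linarith) hup)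
        rw [le_div_iff₀ hup] at this
        linarith
      · intro hle
        by_contra! hlt
        have hlt' : c < x i w := lt_of_le_of_ne hle hne.symm
        have hup : x i u < 0 := by
          by_contra! hh
          nlinarith
        have := htime hup.ne (div_pos_of_neg_of_neg (by linarith) hup)
        rw [le_div_iff_of_neg hup] at this
        linarith
  refine ⟨w + t • u, fun i hi => ⟨(hcross i hi 0 (Or.inl rfl)).1, (hcross i hi 0 (Or.inl rfl)).2,
    (hcross i hi 1 (Or.inr rfl)).1, (hcross i hi 1 (Or.inr rfl)).2⟩, card_lt_card ?_⟩
  rw [ssubset_iff_of_subset]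
  · refine ⟨k, mem_tight.2 ⟨hk'.1, ?_⟩, fun hh => hku (hu k hh)⟩
    have : x k (w + t • u) = e := by
      rw [hval, ← hke]
      simp only
      field_simp
      ring
    rw [this]
    exact hk'.2
  · intro i hi
    refine mem_tight.2 ⟨(mem_tight.1 hi).1, ?_⟩
    rw [hval, hu i hi, mul_zero, add_zero]
    exact (mem_tight.1 hi).2

lemma GenPos.exists_vertex_of_one_le [FiniteDimensional ℝ W] {x : ι → Dual ℝ W} {X : Finset ι}
    (h : GenPos x X) (hX : finrank ℝ W ≤ #X) {w : W} {i : ι} (hi : i ∈ X) (hw : 1 ≤ x i w) :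
    ∃ v, v ≠ 0 ∧ InClosure x X w v ∧ #(tight x X v) = finrank ℝ W := by
  induction hn : finrank ℝ W - #(tight x X w) using Nat.strong_induction_on generalizing w with
  | _ n ih =>
    have hw0 : w ≠ 0 := by
      rintro rfl
      rw [map_zero] at hw
      linarith
    rcases (h w hw0).2.lt_or_eq with hlt | heq
    · obtain ⟨v, hv, ht⟩ := h.exists_tight_lt hX hlt
      obtain ⟨z, hz0, hz, hzt⟩ := ih _ (by omega) ((hv i hi).2.2.2 hw) rfl
      exact ⟨z, hz0, hv.trans hz, hzt⟩
    · exact ⟨w, hw0, fun i hi => ⟨id, id, id, id⟩, heq⟩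

/-- The closure of a cell with a positive functional has a vertex other than the origin. -/
lemma GenPos.exists_vertex [FiniteDimensional ℝ W] {x : ι → Dual ℝ W} {X : Finset ι}
    (h : GenPos x X) (hX : finrank ℝ W ≤ #X) {w : W} {i : ι} (hi : i ∈ X) (hw : 0 < x i w) :
    ∃ v, v ≠ 0 ∧ InClosure x X w v ∧ #(tight x X v) = finrank ℝ W := by
  classical
  by_cases h1 : ∃ j ∈ X, 1 ≤ x j w
  · obtain ⟨j, hj, h1⟩ := h1
    exact h.exists_vertex_of_one_le hX hj h1
  · push Not at h1
    -- Scale up until the largest functional reaches the value `1`.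
    obtain ⟨j, hj, hmax⟩ := exists_max_image X (fun j => x j w) ⟨i, hi⟩
    have hM : 0 < x j w := hw.trans_le (hmax i hi)
    have hcl : InClosure x X w ((x j w)⁻¹ • w) := by
      intro k hk
      have hinv : 0 < (x j w)⁻¹ := inv_pos.2 hM
      simp only [map_smul, smul_eq_mul]
      refine ⟨fun hh => mul_nonpos_of_nonneg_of_nonpos hinv.le hh,
        fun hh => mul_nonneg hinv.le hh, fun _ => ?_, fun hh => absurd hh (h1 k hk).not_ge⟩
      rw [inv_mul_le_iff₀ hM, mul_one]
      exact hmax k hk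
    obtain ⟨v, hv0, hv, ht⟩ := h.exists_vertex_of_one_le (w := (x j w)⁻¹ • w) hX hj
      (by simp [hM.ne'])
    exact ⟨v, hv0, hcl.trans hv, ht⟩

lemma InClosure.mids_subset {x : ι → Dual ℝ W} {X : Finset ι} {w v : W}
    (h : InClosure x X w v) : mids x X v ⊆ mids x X w := by
  intro i hi
  rw [mem_mids] at hi ⊢
  obtain ⟨a, b, c, d⟩ := h i hi.1
  refine ⟨hi.1, ?_, ?_⟩ <;> by_contra! hh
  · linarith [a hh]
  · linarith [d hh]

/-- A cell is determined by a vertex in its closure and the sides on which it lies of the walls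
through the vertex. -/
lemma InClosure.wallSign_eq {x : ι → Dual ℝ W} {X : Finset ι} {w v w' v' : W}
    (h : InClosure x X w v) (h' : InClosure x X w' v') (hc : cell x X v = cell x X v') {i : ι}
    (hi : i ∈ X) (hs : i ∈ tight x X v → SignType.sign (x i w - x i v) =
      SignType.sign (x i w' - x i v')) : wallSign (x i w) = wallSign (x i w') := by
  obtain ⟨a, b, c, d⟩ := h i hi
  obtain ⟨a', b', c', d'⟩ := h' i hi
  obtain ⟨e1, e2, e3, e4⟩ := wallSign_eq_iff.1 (cell_eq_iff.1 hc i hi)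
  rw [wallSign_eq_iff]
  by_cases ht : i ∈ tight x X v
  · have hs := hs ht
    have k1 : x i w - x i v < 0 ↔ x i w' - x i v' < 0 := by
      rw [← sign_eq_neg_one_iff, hs, sign_eq_neg_one_iff]
    have k2 : 0 < x i w - x i v ↔ 0 < x i w' - x i v' := by
      rw [← sign_eq_one_iff, hs, sign_eq_one_iff]
    rcases (mem_tight.1 ht).2 with h0 | h0
    · have h0' := e2.1 h0
      rw [h0, h0'] at *
      grind
    · have h0' := e3.1 h0
      rw [h0, h0'] at *
      grind
  · have : ¬ (x i v = 0 ∨ x i v = 1) := fun hh => ht (mem_tight.2 ⟨hi, hh⟩)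
    grind

lemma sum_range_choose_le (m k : ℕ) : ∑ j ∈ range (k + 1), m.choose j ≤ (m + 1) ^ k := by
  rw [add_pow]
  refine sum_le_sum fun j hj => ?_
  have h1 : 0 < k.choose j := Nat.choose_pos (by simpa [Nat.lt_succ_iff] using hj)
  calc m.choose j ≤ m ^ j := Nat.choose_le_pow m j
    _ ≤ _ := by simpa using Nat.le_mul_of_pos_right _ h1

/-- The cells on which no functional is positive are determined by their central walls. -/
lemma GenPos.card_cells_nonpos_le [Fintype ι] {x : ι → Dual ℝ W} {X : Finset ι}
    (h : GenPos x X) (hD : 0 < finrank ℝ W) :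
    #(cells x X fun w => ∀ i ∈ X, x i w ≤ 0) ≤ (#X + 1) ^ (finrank ℝ W - 1) + 1 := by
  classical
  let B : Finset (Finset ι) := (range (finrank ℝ W - 1 + 1)).biUnion fun j => X.powersetCard j
  have hB : #B ≤ (#X + 1) ^ (finrank ℝ W - 1) :=
    card_biUnion_le.trans (by simpa using sum_range_choose_le #X (finrank ℝ W - 1))
  refine (card_cells_le (fun w => X.filter fun i => x i w = 0) (insert X B) ?_ ?_).trans
    ((card_insert_le _ _).trans (Nat.add_le_add_right hB 1))
  · intro w hw
    by_cases hw0 : w = 0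
    · simp [hw0]
    · refine mem_insert_of_mem (mem_biUnion.2 ⟨_, ?_, mem_powersetCard.2 ⟨filter_subset _ _, rfl⟩⟩)
      have := (h w hw0).1
      rw [mem_range]
      omega
  · intro w w' hw hw' he
    refine cell_eq_iff.2 fun i hi => ?_
    have h1 : x i w = 0 ↔ x i w' = 0 := by
      have := Finset.ext_iff.1 he i
      simpa [hi] using this
    have h2 := hw i hi
    have h3 := hw' i hi
    rw [wallSign_eq_iff]
    grind

lemma GenPos.card_cells_pos_le [Fintype ι] [FiniteDimensional ℝ W] {x : ι → Dual ℝ W}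
    {X : Finset ι} (h : GenPos x X) (hX : finrank ℝ W ≤ #X) (r : ℕ) :
    #(cells x X fun w => #(mids x X w) ≤ r ∧ ∃ i ∈ X, 0 < x i w) ≤
      vertexCount x X r * 3 ^ finrank ℝ W := by
  classical
  have hv : ∀ w, (#(mids x X w) ≤ r ∧ ∃ i ∈ X, 0 < x i w) →
      ∃ v, v ≠ 0 ∧ InClosure x X w v ∧ #(tight x X v) = finrank ℝ W := by
    rintro w ⟨-, i, hi, hpos⟩
    exact h.exists_vertex hX hi hpos
  choose! V hV0 hV hVt using hv
  let T : (ι → SignType × SignType) → Finset ι :=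
    fun τ => X.filter fun i => (τ i).1 = 0 ∨ (τ i).2 = 0
  have hT : ∀ v, T (cell x X v) = tight x X v := by
    intro v
    ext i
    by_cases hi : i ∈ X
    · rw [mem_filter, mem_tight]
      simp [hi, cell, wallSign, sub_eq_zero]
    · simp [T, hi, mem_tight]
  let vs := cells x X fun w => w ≠ 0 ∧ #(tight x X w) = finrank ℝ W ∧ #(mids x X w) ≤ r
  let B : Finset ((ι → SignType × SignType) × (ι → SignType)) := vs.biUnion fun τ =>
    {τ} ×ˢ Fintype.piFinset fun i => if i ∈ T τ then univ else {0}
  have hBc : #B ≤ vertexCount x X r * 3 ^ finrank ℝ W := by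
    refine card_biUnion_le_card_mul _ _ _ fun τ hτ => ?_
    obtain ⟨v, hv, rfl⟩ := mem_cells.1 hτ
    rw [card_product, card_singleton, one_mul, Fintype.card_piFinset, ← hv.2.1, ← hT v]
    refine le_of_eq ?_
    rw [← prod_const, ← prod_subset (subset_univ (T (cell x X v)))]
    · exact prod_congr rfl fun i hi => by rw [if_pos hi]; rfl
    · intro i _ hi
      rw [if_neg hi, card_singleton]
  refine (card_cells_le (fun w => (cell x X (V w), fun i => if i ∈ tight x X (V w) then
    SignType.sign (x i w - x i (V w)) else 0)) B ?_ ?_).trans hBc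
  · intro w hw
    refine mem_biUnion.2 ⟨cell x X (V w), mem_cells.2 ⟨V w, ⟨hV0 w hw, hVt w hw, ?_⟩, rfl⟩, ?_⟩
    · exact (card_le_card (hV w hw).mids_subset).trans hw.1
    · rw [mem_product]
      refine ⟨by simp, Fintype.mem_piFinset.2 fun i => ?_⟩
      rw [hT]
      by_cases hi : i ∈ tight x X (V w) <;> simp [hi]
  · intro w w' hw hw' he
    rw [Prod.mk.injEq] at he
    refine cell_eq_iff.2 fun i hi => (hV w hw).wallSign_eq (hV w' hw') he.1 hi fun ht => ?_
    have := congrFun he.2 i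
    rwa [if_pos ht, if_pos (tight_congr he.1 ▸ ht)] at this

/-- All cells between at most `r` pairs of walls are counted by their vertices. -/
lemma GenPos.card_cells_mids_le [Fintype ι] [FiniteDimensional ℝ W] {x : ι → Dual ℝ W}
    {X : Finset ι} (h : GenPos x X) (hD : 0 < finrank ℝ W) (r : ℕ) :
    #(cells x X fun w => #(mids x X w) ≤ r) ≤ vertexCount x X r * 3 ^ finrank ℝ W +
      ((#X + 1) ^ (finrank ℝ W - 1) + 1) + 9 ^ finrank ℝ W := by
  rcases le_or_gt (finrank ℝ W) #X with hX | hX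
  · refine le_trans ?_ (Nat.le_add_right _ _)
    refine (card_cells_mono (Q := fun w => (#(mids x X w) ≤ r ∧ ∃ i ∈ X, 0 < x i w) ∨
      ∀ i ∈ X, x i w ≤ 0) fun w hw => ?_).trans ((card_cells_or _ _).trans
      (add_le_add (h.card_cells_pos_le hX r) (h.card_cells_nonpos_le hD)))
    by_cases hp : ∃ i ∈ X, 0 < x i w
    · exact Or.inl ⟨hw, hp⟩
    · push Not at hp
      exact Or.inr hp
  · exact ((card_cells_le_pow x X _).trans (Nat.pow_le_pow_right (by norm_num) hX.le)).trans
      (Nat.le_add_left _ _)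

end Vertices

/-! ### Lowest vertices -/

section LowestVertex
variable {ι W : Type} [AddCommGroup W] [Module ℝ W]

lemma InClosure.congr_left {x : ι → Dual ℝ W} {X : Finset ι} {p q v : W}
    (h : InClosure x X p v) (he : cell x X p = cell x X q) : InClosure x X q v := fun i hi => by
  obtain ⟨a, b, c, d⟩ := h i hi
  obtain ⟨e1, e2, e3, e4⟩ := wallSign_eq_iff.1 (cell_eq_iff.1 he i hi)
  grind

open Classical in
/-- The walls through the vertex `w` for which moving away from the region between the pair of
walls decreases `φ`; `U T` is the basis dual to the functionals in `T`. -/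
noncomputable def descents (x : ι → Dual ℝ W) (X : Finset ι) (U : Finset ι → ι → W)
    (φ : Dual ℝ W) (w : W) : Finset ι :=
  {t ∈ tight x X w | 0 < φ (U (tight x X w) t) ↔ x t w = 0}

/-- Moving a point on some walls and between no pair of walls off a set of these walls, outwards
and by a small amount. -/
lemma GenPos.exists_push_off [FiniteDimensional ℝ W] [DecidableEq ι] {x : ι → Dual ℝ W}
    {X : Finset ι} (h : GenPos x X) {w : W} (ht : #(tight x X w) = finrank ℝ W)
    (hm : mids x X w = ∅) {S : Finset ι} (hS : S ⊆ tight x X w) :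
    ∃ p, InClosure x X p w ∧ (∀ t ∈ S, x t p = x t w) ∧
      (∀ t ∈ tight x X w, t ∉ S → (x t w = 0 → x t p < 0) ∧ (x t w = 1 → 1 < x t p)) ∧
      tight x X p = S ∧ mids x X p = ∅ := by
  classical
  have hTX : tight x X w ⊆ X := fun i hi => (mem_tight.1 hi).1
  obtain ⟨d, hd⟩ := h.exists_apply_eq hTX ht
    (fun t => if t ∈ S then 0 else if x t w = 0 then -1 else 1)
  have hsmall : ∀ᶠ s : ℝ in nhdsWithin 0 (Set.Ioi 0), 0 < s ∧ ∀ i ∈ X,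
      (x i w < 0 → x i w + s * x i d < 0) ∧ (1 < x i w → 1 < x i w + s * x i d) := by
    refine (eventually_mem_nhdsWithin).and ((Finset.eventually_all X).2 fun i _ => ?_)
    have hc : Filter.Tendsto (fun s : ℝ => x i w + s * x i d) (nhdsWithin 0 (Set.Ioi 0))
        (nhds (x i w)) := by
      refine Filter.Tendsto.mono_left ?_ nhdsWithin_le_nhds
      have : Continuous fun s : ℝ => x i w + s * x i d := by fun_prop
      simpa using this.tendsto 0
    refine Filter.Eventually.and ?_ ?_
    · by_cases h0 : x i w < 0
      · exact (hc.eventually_lt_const h0).mono fun _ h _ => h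
      · exact Filter.Eventually.of_forall fun _ h => absurd h h0
    · by_cases h0 : 1 < x i w
      · exact (hc.eventually_const_lt h0).mono fun _ h _ => h
      · exact Filter.Eventually.of_forall fun _ h => absurd h h0
  obtain ⟨s, hs, hsX⟩ := hsmall.exists
  have hval : ∀ i, x i (w + s • d) = x i w + s * x i d := fun i => by simp
  have hk : ∀ t ∈ S, x t (w + s • d) = x t w := fun t hts => by
    rw [hval, hd t (hS hts), if_pos hts, mul_zero, add_zero]
  have hoff : ∀ t ∈ tight x X w, t ∉ S →
      (x t w = 0 → x t (w + s • d) < 0) ∧ (x t w = 1 → 1 < x t (w + s • d)) := by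
    intro t ht hts
    rw [hval, hd t ht, if_neg hts]
    constructor
    · intro e
      rw [if_pos e, e]
      linarith
    · intro e
      rw [if_neg (by rw [e]; norm_num), e]
      linarith
  -- every functional not in `S` is strictly outside at the new point
  have hout : ∀ i ∈ X, i ∉ S → (x i w ≤ 0 ∧ x i (w + s • d) < 0) ∨
      (1 ≤ x i w ∧ 1 < x i (w + s • d)) := by
    intro i hi hiS
    by_cases hit : i ∈ tight x X w
    · rcases (mem_tight.1 hit).2 with e | e
      · exact Or.inl ⟨e.le, (hoff i hit hiS).1 e⟩
      · exact Or.inr ⟨e.ge, (hoff i hit hiS).2 e⟩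
    · have h1 : ¬ (x i w = 0 ∨ x i w = 1) := fun hh => hit (mem_tight.2 ⟨hi, hh⟩)
      have h2 : ¬ (0 < x i w ∧ x i w < 1) := fun hh => by
        have : i ∈ mids x X w := mem_mids.2 ⟨hi, hh⟩
        simp [hm] at this
      have h3 := hsX i hi
      rw [← hval] at h3
      grind
  refine ⟨w + s • d, fun i hi => ?_, hk, hoff, ?_, ?_⟩
  · by_cases hiS : i ∈ S
    · rw [hk i hiS]
      exact ⟨id, id, id, id⟩
    · have := hout i hi hiS
      refine ⟨?_, ?_, ?_, ?_⟩ <;> intro <;> grind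
  · ext i
    rw [mem_tight]
    constructor
    · rintro ⟨hi, hh⟩
      by_contra hiS
      have := hout i hi hiS
      grind
    · intro hiS
      rw [hk i hiS]
      exact mem_tight.1 (hS hiS)
  · refine eq_empty_of_forall_notMem fun i hi => ?_
    rw [mem_mids] at hi
    by_cases hiS : i ∈ S
    · rw [hk i hiS] at hi
      have : i ∈ mids x X w := mem_mids.2 hi
      simp [hm] at this
    · have := hout i hi.1 hiS
      grind

/-- A vertex with few descents is the unique lowest vertex of a face of small codimension: the
face that keeps exactly the walls in which the functional descends. -/
lemma GenPos.card_few_descents_le [Fintype ι] [FiniteDimensional ℝ W] [DecidableEq ι]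
    {x : ι → Dual ℝ W} {X : Finset ι} (h : GenPos x X) {U : Finset ι → ι → W} {φ : Dual ℝ W}
    (hU : ∀ T ⊆ X, #T = finrank ℝ W → ∀ t ∈ T, ∀ s ∈ T, x s (U T t) = if s = t then 1 else 0)
    (hφ : ∀ T ⊆ X, #T = finrank ℝ W → ∀ t ∈ T, φ (U T t) ≠ 0) (l : ℕ) :
    #(cells x X fun w => (#(tight x X w) = finrank ℝ W ∧ mids x X w = ∅) ∧
      #(descents x X U φ w) ≤ l) ≤ ∑ k ∈ range (l + 1), faceCount x X k := by
  classical
  have hex : ∀ w, ((#(tight x X w) = finrank ℝ W ∧ mids x X w = ∅) ∧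
      #(descents x X U φ w) ≤ l) → _ := fun w hw =>
    h.exists_push_off hw.1.1 hw.1.2 (S := descents x X U φ w) (filter_subset _ _)
  choose! p hpw hpS hpT hpt hpm using hex
  refine (card_cells_le (fun w => cell x X (p w)) ((range (l + 1)).biUnion fun k =>
    cells x X fun w => #(tight x X w) = k ∧ mids x X w = ∅) ?_ ?_).trans card_biUnion_le
  · intro w hw
    refine mem_biUnion.2 ⟨#(descents x X U φ w), ?_, mem_cells.2 ⟨p w, ⟨?_, hpm w hw⟩, rfl⟩⟩
    · rw [mem_range]
      omega
    · rw [hpt w hw]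
  · have hsum : ∀ T ⊆ X, #T = finrank ℝ W → ∀ v, φ v = ∑ t ∈ T, x t v * φ (U T t) := by
      intro T hT hc v
      have : v = ∑ t ∈ T, x t v • U T t := by
        refine h.eq_of_eqOn hT hc.ge fun s hs => ?_
        rw [map_sum, sum_eq_single s]
        · simp [hU T hT hc s hs s hs]
        · intro t ht hne
          simp [hU T hT hc t ht s hs, hne.symm]
        · exact fun hh => absurd hs hh
      conv_lhs => rw [this]
      simp
    -- every point of the closed face is at least as high as the vertex
    have hterm : ∀ w w', ((#(tight x X w) = finrank ℝ W ∧ mids x X w = ∅) ∧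
        #(descents x X U φ w) ≤ l) → InClosure x X (p w) w' → ∀ t ∈ tight x X w,
        0 ≤ (x t w' - x t w) * φ (U (tight x X w) t) := by
      intro w w' hw hcl t ht
      have htX := (mem_tight.1 ht).1
      obtain ⟨a, b, c, d⟩ := hcl t htX
      have hne := hφ _ (fun i hi => (mem_tight.1 hi).1) hw.1.1 t ht
      by_cases htd : t ∈ descents x X U φ w
      · have e := hpS w hw t htd
        rw [e] at a b c d
        have : x t w' = x t w := by
          rcases (mem_tight.1 ht).2 with e0 | e0
          · rw [e0] at a b ⊢
            exact le_antisymm (a le_rfl) (b le_rfl)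
          · rw [e0] at c d ⊢
            exact le_antisymm (c le_rfl) (d le_rfl)
        rw [this, sub_self, zero_mul]
      · obtain ⟨k0, k1⟩ := hpT w hw t ht htd
        have hnd : ¬ (0 < φ (U (tight x X w) t) ↔ x t w = 0) := fun hh =>
          htd (mem_filter.2 ⟨ht, hh⟩)
        rcases (mem_tight.1 ht).2 with e0 | e0
        · have hneg : φ (U (tight x X w) t) < 0 := by
            rcases lt_or_gt_of_ne hne with hh | hh
            · exact hh
            · exact absurd (iff_of_true hh e0) hnd
          have := a (k0 e0).le
          rw [e0]
          nlinarith
        · have hpos : 0 < φ (U (tight x X w) t) := by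
            rcases lt_or_gt_of_ne hne with hh | hh
            · exact absurd (iff_of_false hh.not_gt (by rw [e0]; norm_num)) hnd
            · exact hh
          have := d (k1 e0).le
          rw [e0]
          nlinarith
    have hdiff : ∀ w w', ((#(tight x X w) = finrank ℝ W ∧ mids x X w = ∅) ∧
        #(descents x X U φ w) ≤ l) →
        φ w' - φ w = ∑ t ∈ tight x X w, (x t w' - x t w) * φ (U (tight x X w) t) := by
      intro w w' hw
      have hT : tight x X w ⊆ X := fun i hi => (mem_tight.1 hi).1
      rw [hsum _ hT hw.1.1 w', hsum _ hT hw.1.1 w, ← sum_sub_distrib]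
      exact sum_congr rfl fun t _ => by ring
    intro w w' hw hw' he
    have hc1 : InClosure x X (p w) w' := (hpw w' hw').congr_left he.symm
    have hc2 : InClosure x X (p w') w := (hpw w hw).congr_left he
    have hle1 : 0 ≤ φ w' - φ w := by
      rw [hdiff w w' hw]
      exact sum_nonneg (hterm w w' hw hc1)
    have hle2 : 0 ≤ φ w - φ w' := by
      rw [hdiff w' w hw']
      exact sum_nonneg (hterm w' w hw' hc2)
    have hz : ∑ t ∈ tight x X w, (x t w' - x t w) * φ (U (tight x X w) t) = 0 := by
      rw [← hdiff w w' hw]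
      linarith
    have hT : tight x X w ⊆ X := fun i hi => (mem_tight.1 hi).1
    have : w' = w := h.eq_of_eqOn hT hw.1.1.ge fun t ht => by
      have := (sum_eq_zero_iff_of_nonneg (hterm w w' hw hc1)).1 hz t ht
      have := (mul_eq_zero.1 this).resolve_right (hφ _ hT hw.1.1 t ht)
      linarith
    rw [this]

/-- The vertices are bounded by the faces of at most half the full codimension: for a generic
linear functional each vertex is the unique lowest or highest vertex of such a face. -/
lemma GenPos.vertexCount_zero_le [Fintype ι] [FiniteDimensional ℝ W] {x : ι → Dual ℝ W}
    {X : Finset ι} (h : GenPos x X) :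
    vertexCount x X 0 ≤ 2 * ∑ k ∈ range (finrank ℝ W / 2 + 1), faceCount x X k := by
  classical
  have hex : ∀ T t, (T ⊆ X ∧ #T = finrank ℝ W ∧ t ∈ T) →
      ∃ u, ∀ s ∈ T, x s u = if s = t then 1 else 0 := fun T t hT =>
    h.exists_apply_eq hT.1 hT.2.1 _
  choose! U hU using hex
  obtain ⟨φ, hφ⟩ := Module.exists_dual_forall_apply_ne_zero (K := ℝ)
    (fun p : {p : Finset ι × ι // p.1 ⊆ X ∧ #p.1 = finrank ℝ W ∧ p.2 ∈ p.1} =>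
      U p.1.1 p.1.2) (fun p h0 => by
      have := hU p.1.1 p.1.2 p.2 p.1.2 p.2.2.2
      rw [h0] at this
      simp at this)
  have hU' : ∀ T ⊆ X, #T = finrank ℝ W → ∀ t ∈ T, ∀ s ∈ T,
      x s (U T t) = if s = t then 1 else 0 := fun T hT hc t ht => hU T t ⟨hT, hc, ht⟩
  have hφ' : ∀ T ⊆ X, #T = finrank ℝ W → ∀ t ∈ T, φ (U T t) ≠ 0 :=
    fun T hT hc t ht => hφ ⟨(T, t), hT, hc, ht⟩
  have h1 := h.card_few_descents_le hU' hφ' (finrank ℝ W / 2)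
  have h2 := h.card_few_descents_le (φ := -φ) hU'
    (fun T hT hc t ht => neg_ne_zero.2 (hφ' T hT hc t ht)) (finrank ℝ W / 2)
  refine (card_cells_mono (Q := fun w =>
    ((#(tight x X w) = finrank ℝ W ∧ mids x X w = ∅) ∧
      #(descents x X U φ w) ≤ finrank ℝ W / 2) ∨
    ((#(tight x X w) = finrank ℝ W ∧ mids x X w = ∅) ∧
      #(descents x X U (-φ) w) ≤ finrank ℝ W / 2)) ?_).trans
    ((card_cells_or _ _).trans (by rw [two_mul]; exact add_le_add h1 h2))
  rintro w ⟨-, ht, hm⟩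
  have hm' : mids x X w = ∅ := by simpa using hm
  -- the descents of `-φ` are the ascents of `φ`
  have hd : descents x X U (-φ) w ⊆ tight x X w \ descents x X U φ w := by
    intro t htd
    obtain ⟨htt, hiff⟩ := mem_filter.1 htd
    refine mem_sdiff.2 ⟨htt, fun hh => ?_⟩
    have hiff' := (mem_filter.1 hh).2
    have hne := hφ' _ (fun i hi => (mem_tight.1 hi).1) ht t htt
    rw [← hiff', LinearMap.neg_apply] at hiff
    rcases lt_or_gt_of_ne hne with hlt | hlt
    · exact absurd (hiff.1 (by linarith)) hlt.not_gt
    · exact absurd (hiff.2 hlt) (by linarith)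
  have hc := card_le_card hd
  have hsub : descents x X U φ w ⊆ tight x X w := filter_subset _ _
  rw [card_sdiff_of_subset hsub, ht] at hc
  have : #(descents x X U φ w) ≤ finrank ℝ W / 2 ∨
      #(descents x X U (-φ) w) ≤ finrank ℝ W / 2 := by omega
  tauto

end LowestVertex

/-! ### Planar arrangements -/

section Zone
variable {ι W : Type} [AddCommGroup W] [Module ℝ W]

/-- The breakpoints of the minimum of the positive values of affine functions on the line. At a
breakpoint of two increasing functions the steeper one rises for good above a function that stays
positive, so it is the steeper one at a single breakpoint; likewise, leftwards, for two decreasing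
ones. Between two zeros the minima of the increasing and of the decreasing functions cross at most
once. -/
lemma card_breakpoints_le (α c : ι → ℝ) (X : Finset ι) (Z : Finset ℝ)
    (hZ : ∀ z ∈ Z, ∃ s > 0, (∀ i ∈ X, α i + c i * z < 0 ∨ s ≤ α i + c i * z) ∧
      ∃ i ∈ X, ∃ j ∈ X, α i + c i * z = s ∧ α j + c j * z = s ∧ c i < c j) :
    #Z ≤ 3 * #X + 1 := by
  classical
  rcases Z.eq_empty_or_nonempty with rfl | ⟨z0, hz0⟩
  · simp
  have : Nonempty ι := by
    obtain ⟨-, -, -, i, -⟩ := hZ z0 hz0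
    exact ⟨i⟩
  choose! s hs hX i hi j hj hsi hsj hlt using hZ
  -- the breakpoints by the signs of the two slopes
  let Z1 := Z.filter fun z => 0 ≤ c (i z)
  let Z2 := Z.filter fun z => c (j z) < 0
  let Z3 := Z.filter fun z => c (i z) < 0 ∧ 0 ≤ c (j z)
  have hcover : Z ⊆ Z1 ∪ Z2 ∪ Z3 := by
    intro z hz
    simp only [Z1, Z2, Z3, mem_union, mem_filter, hz, true_and]
    grind
  have h1 : #Z1 ≤ #X := by
    have key : ∀ z ∈ Z1, ∀ z' ∈ Z1, j z = j z' → ¬ z < z' := by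
      intro z hz z' hz' he hzz
      obtain ⟨hz, hc⟩ := mem_filter.1 hz
      obtain ⟨hz', hc'⟩ := mem_filter.1 hz'
      have e1 := hsi z hz
      have e2 := hsj z hz
      have e3 := hsj z' hz'
      have l1 := hlt z hz
      rw [← he] at e3
      have p1 := mul_nonneg hc (sub_nonneg.2 hzz.le)
      have p2 := mul_pos (sub_pos.2 l1) (sub_pos.2 hzz)
      rcases hX z' hz' (i z) (hi z hz) with h | h
      · linarith [hs z hz]
      · linarith
    refine card_le_card_of_injOn j (fun z hz => hj z (mem_filter.1 hz).1) fun z hz z' hz' he => ?_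
    exact le_antisymm (not_lt.1 (key z' hz' z hz he.symm)) (not_lt.1 (key z hz z' hz' he))
  have h2 : #Z2 ≤ #X := by
    have key : ∀ z ∈ Z2, ∀ z' ∈ Z2, i z = i z' → ¬ z < z' := by
      intro z hz z' hz' he hzz
      obtain ⟨hz, hc⟩ := mem_filter.1 hz
      obtain ⟨hz', hc'⟩ := mem_filter.1 hz'
      have e1 := hsi z hz
      have e2 := hsj z' hz'
      have e3 := hsi z' hz'
      have l1 := hlt z' hz'
      rw [← he] at e3 l1
      have p1 := mul_pos (neg_pos.2 hc') (sub_pos.2 hzz)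
      have p2 := mul_pos (sub_pos.2 l1) (sub_pos.2 hzz)
      rcases hX z hz (j z') (hj z' hz') with h | h
      · linarith [hs z' hz']
      · linarith
    refine card_le_card_of_injOn i (fun z hz => hi z (mem_filter.1 hz).1) fun z hz z' hz' he => ?_
    exact le_antisymm (not_lt.1 (key z' hz' z hz he.symm)) (not_lt.1 (key z hz z' hz' he))
  have h3 : #Z3 ≤ #X + 1 := by
    -- the indices whose zero is to the left of `z`
    let N : ℝ → Finset ι := fun z => X.filter fun l =>
      (0 ≤ c l ∧ 0 < α l + c l * z) ∨ (c l < 0 ∧ α l + c l * z < 0)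
    have hmono : ∀ z z', z < z' → N z ⊆ N z' := by
      intro z z' hzz l hl
      obtain ⟨hl, hh⟩ := mem_filter.1 hl
      refine mem_filter.2 ⟨hl, ?_⟩
      rcases hh with ⟨ha, hb⟩ | ⟨ha, hb⟩
      · have := mul_nonneg ha (sub_nonneg.2 hzz.le)
        exact Or.inl ⟨ha, by linarith⟩
      · have := mul_pos (neg_pos.2 ha) (sub_pos.2 hzz)
        exact Or.inr ⟨ha, by linarith⟩
    have key : ∀ z ∈ Z3, ∀ z' ∈ Z3, #(N z) = #(N z') → ¬ z < z' := by
      intro z hz z' hz' he hzz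
      obtain ⟨hz, hc1, hc2⟩ := mem_filter.1 hz
      obtain ⟨hz', hc1', hc2'⟩ := mem_filter.1 hz'
      have hN : N z = N z' := eq_of_subset_of_card_le (hmono z z' hzz) he.ge
      have a1 : j z' ∈ N z := by
        rw [hN]
        exact mem_filter.2 ⟨hj z' hz', Or.inl ⟨hc2', by rw [hsj z' hz']; exact hs z' hz'⟩⟩
      have a2 : i z ∉ N z' := by
        rw [← hN]
        intro hh
        have e := hsi z hz
        have e' := hs z hz
        rcases (mem_filter.1 hh).2 with ⟨hh, -⟩ | ⟨-, hh⟩ <;> linarith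
      have b1 : 0 < α (j z') + c (j z') * z := by
        rcases (mem_filter.1 a1).2 with ⟨-, hh⟩ | ⟨hh, -⟩
        · exact hh
        · linarith
      have b2 : ¬ α (i z) + c (i z) * z' < 0 := fun hh =>
        a2 (mem_filter.2 ⟨hi z hz, Or.inr ⟨hc1, hh⟩⟩)
      have c1 := (hX z hz _ (hj z' hz')).resolve_left b1.not_gt
      have c2 := (hX z' hz' _ (hi z hz)).resolve_left b2
      have e1 := hsi z hz
      have e2 := hsj z' hz'
      have p1 := mul_nonneg hc2' (sub_nonneg.2 hzz.le)
      have p2 := mul_pos (neg_pos.2 hc1) (sub_pos.2 hzz)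
      linarith
    refine (card_le_card_of_injOn (t := range (#X + 1)) (fun z => #(N z)) (fun z _ => ?_)
      fun z hz z' hz' he => ?_).trans (card_range _).le
    · simpa [Nat.lt_succ_iff] using card_le_card (filter_subset _ X)
    · exact le_antisymm (not_lt.1 (key z' hz' z hz he.symm)) (not_lt.1 (key z hz z' hz' he))
  have := card_le_card hcover
  have := card_union_le (Z1 ∪ Z2) Z3
  have := card_union_le Z1 Z2
  omega

lemma exists_representatives [Fintype ι] (x : ι → Dual ℝ W) (X : Finset ι) (P : W → Prop) :
    ∃ S : Finset W, #S = #(cells x X P) ∧ ∀ w ∈ S, P w := by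
  classical
  have hc : ∀ σ ∈ cells x X P, ∃ w, P w ∧ cell x X w = σ := fun σ h => mem_cells.1 h
  choose! g hg using hc
  refine ⟨(cells x X P).image g, card_image_of_injOn ?_, ?_⟩
  · intro σ hσ τ hτ h
    rw [← (hg σ hσ).2, ← (hg τ hτ).2, h]
  · intro w hw
    obtain ⟨σ, hσ, rfl⟩ := mem_image.1 hw
    exact (hg σ hσ).1

/-- Two outer vertices, that is, vertices between no pair of walls, that lie on the same ray from the
origin and on noncentral walls coincide. -/
lemma eq_of_smul_vertex {x : ι → Dual ℝ W} {X : Finset ι} {w w' : W} (hm : mids x X w = ∅)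
    (hm' : mids x X w' = ∅) {i j : ι} (hi : i ∈ X) (hj : j ∈ X) (h1 : x i w = 1)
    (h1' : x j w' = 1) {r : ℝ} (hr : 0 < r) (he : w' = r • w) : w' = w := by
  have a : ¬ (0 < x i w' ∧ x i w' < 1) := fun hh => by
    have : i ∈ mids x X w' := mem_mids.2 ⟨hi, hh⟩
    simp [hm'] at this
  have b : ¬ (0 < x j w ∧ x j w < 1) := fun hh => by
    have : j ∈ mids x X w := mem_mids.2 ⟨hj, hh⟩
    simp [hm] at this
  have e1 : x i w' = r := by rw [he, map_smul, h1, smul_eq_mul, mul_one]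
  have e2 : r * x j w = 1 := by rw [← smul_eq_mul, ← map_smul, ← he, h1']
  have r1 : 1 ≤ r := by
    by_contra! hh
    exact a ⟨by rw [e1]; exact hr, by rw [e1]; exact hh⟩
  have r2 : r = 1 := by
    have hpos : 0 < x j w := by
      by_contra! hh
      nlinarith
    have : 1 ≤ x j w := by
      by_contra! hh
      exact b ⟨hpos, hh⟩
    nlinarith
  rw [he, r2, one_smul]

/-- The outer vertices of a planar arrangement with both functionals equal to one, in one of the
half-planes of a coordinate. -/
lemma GenPos.card_plane_half_le [Fintype ι] [FiniteDimensional ℝ W] {x : ι → Dual ℝ W}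
    {X : Finset ι} (h : GenPos x X) (hD : finrank ℝ W = 2) (b : Basis (Fin 2) ℝ W) {ε : ℝ}
    (hε : ε * ε = 1) :
    #(cells x X fun w => (#(tight x X w) = 2 ∧ mids x X w = ∅ ∧ ∀ i ∈ X, x i w ≠ 0) ∧
      0 < ε * b.repr w 0) ≤ 3 * #X + 1 := by
  classical
  obtain ⟨S, hS, hP⟩ := exists_representatives x X fun w =>
    (#(tight x X w) = 2 ∧ mids x X w = ∅ ∧ ∀ i ∈ X, x i w ≠ 0) ∧ 0 < ε * b.repr w 0
  rw [← hS]
  let z : W → ℝ := fun w => b.repr w 1 / (ε * b.repr w 0)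
  let α : ι → ℝ := fun i => ε * x i (b 0)
  let c : ι → ℝ := fun i => x i (b 1)
  have hexp : ∀ i w, x i w = b.repr w 0 * x i (b 0) + b.repr w 1 * x i (b 1) := by
    intro i w
    conv_lhs => rw [← b.sum_repr w, map_sum, Fin.sum_univ_two]
    simp
  have hval : ∀ i w, 0 < ε * b.repr w 0 → α i + c i * z w = x i w / (ε * b.repr w 0) := by
    intro i w hw
    rw [hexp, eq_div_iff hw.ne']
    simp only [α, c, z]
    rw [add_mul, mul_assoc (x i (b 1)), div_mul_cancel₀ _ hw.ne']
    linear_combination (x i (b 0) * b.repr w 0) * hε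
  have hcond : ∀ w ∈ S, (0 < 1 / (ε * b.repr w 0)) ∧ (∀ i ∈ X, α i + c i * z w < 0 ∨
      1 / (ε * b.repr w 0) ≤ α i + c i * z w) ∧
      ∃ i ∈ X, ∃ j ∈ X, α i + c i * z w = 1 / (ε * b.repr w 0) ∧
        α j + c j * z w = 1 / (ε * b.repr w 0) ∧ c i < c j := by
    intro w hw
    obtain ⟨⟨ht, hm, hnz⟩, hpos⟩ := hP w hw
    refine ⟨one_div_pos.2 hpos, fun i hi => ?_, ?_⟩
    · rw [hval i w hpos]
      have hn : ¬ (0 < x i w ∧ x i w < 1) := fun hh => by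
        have : i ∈ mids x X w := mem_mids.2 ⟨hi, hh⟩
        simp [hm] at this
      rcases lt_or_gt_of_ne (hnz i hi) with h0 | h0
      · exact Or.inl (div_neg_of_neg_of_pos h0 hpos)
      · exact Or.inr (div_le_div_of_nonneg_right (by grind) hpos.le)
    · obtain ⟨i, j, hij, he⟩ := card_eq_two.1 ht
      have hi : i ∈ tight x X w := by simp [he]
      have hj : j ∈ tight x X w := by simp [he]
      rw [mem_tight] at hi hj
      have hi1 := hi.2.resolve_left (hnz i hi.1)
      have hj1 := hj.2.resolve_left (hnz j hj.1)
      have ei : α i + c i * z w = 1 / (ε * b.repr w 0) := by rw [hval i w hpos, hi1]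
      have ej : α j + c j * z w = 1 / (ε * b.repr w 0) := by rw [hval j w hpos, hj1]
      have hne : c i ≠ c j := by
        intro hc
        have hα : α i = α j := by
          rw [hc] at ei
          linarith
        have hε0 : ε ≠ 0 := by
          rintro rfl
          simp at hε
        have h0 : x i (b 0) = x j (b 0) := mul_left_cancel₀ hε0 hα
        obtain ⟨u, hu, hui⟩ := exists_ne_zero_of_card_lt x {i} (by rw [hD]; simp)
        have hui' := hui i (mem_singleton_self i)
        have huj : x j u = 0 := by
          rw [hexp, ← h0]
          rw [hexp] at hui'
          simp only [c] at hc
          rw [← hc]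
          exact hui'
        have hsub : ({i, j} : Finset ι) ⊆ X.filter fun l => x l u = 0 := by
          intro l hl
          rcases mem_insert.1 hl with rfl | hl
          · exact mem_filter.2 ⟨hi.1, hui'⟩
          · rw [mem_singleton.1 hl]
            exact mem_filter.2 ⟨hj.1, huj⟩
        have h1 := card_le_card hsub
        have h2 := (h u hu).1
        rw [card_pair hij] at h1
        omega
      rcases lt_or_gt_of_ne hne with hlt | hlt
      · exact ⟨i, hi.1, j, hj.1, ei, ej, hlt⟩
      · exact ⟨j, hj.1, i, hi.1, ej, ei, hlt⟩
  rw [← card_image_of_injOn (f := z) (s := S)]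
  · refine card_breakpoints_le α c X _ fun t ht => ?_
    obtain ⟨w, hw, rfl⟩ := mem_image.1 ht
    obtain ⟨h1, h2, h3⟩ := hcond w hw
    exact ⟨_, h1, h2, h3⟩
  · intro w hw w' hw' he
    have hpos := (hP w hw).2
    have hpos' := (hP w' hw').2
    -- the height is determined by the abscissa
    have hle : ∀ u ∈ S, ∀ v ∈ S, z u = z v → 1 / (ε * b.repr u 0) ≤ 1 / (ε * b.repr v 0) := by
      intro u hu v hv huv
      obtain ⟨-, h2, -⟩ := hcond u hu
      obtain ⟨h1, -, i, hi, -, -, e, -, -⟩ := hcond v hv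
      have := h2 i hi
      rw [huv, e] at this
      exact this.resolve_left h1.not_gt
    have e0 : ε * b.repr w 0 = ε * b.repr w' 0 := by
      have := le_antisymm (hle w hw w' hw' he) (hle w' hw' w hw he.symm)
      rwa [one_div, one_div, inv_inj] at this
    have e1 : b.repr w 1 = b.repr w' 1 := by
      simp only [z] at he
      rw [← e0] at he
      exact (div_left_inj' hpos.ne').1 he
    have e0' : b.repr w 0 = b.repr w' 0 := by
      refine mul_left_cancel₀ (a := ε) ?_ e0
      rintro rfl
      simp at hε
    apply b.repr.injective
    ext l
    fin_cases l
    · exact e0'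
    · exact e1

/-- The planar case: linearly many outer vertices. -/
lemma GenPos.vertexCount_zero_le_of_finrank_two [Fintype ι] [FiniteDimensional ℝ W]
    {x : ι → Dual ℝ W} {X : Finset ι} (h : GenPos x X) (hD : finrank ℝ W = 2) :
    vertexCount x X 0 ≤ 15 * (#X + 1) := by
  classical
  let b : Basis (Fin 2) ℝ W := finBasisOfFinrankEq ℝ W hD
  let V : W → Prop := fun w => w ≠ 0 ∧ #(tight x X w) = 2 ∧ mids x X w = ∅
  have hone : ∀ w, V w → ∃ i ∈ X, x i w = 1 := by
    rintro w ⟨hw, ht, hm⟩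
    by_contra! hh
    have h1 := (h w hw).1
    have : tight x X w ⊆ X.filter fun i => x i w = 0 := fun i hi => by
      rw [mem_tight] at hi
      exact mem_filter.2 ⟨hi.1, hi.2.resolve_right (hh i hi.1)⟩
    have := card_le_card this
    omega
  have hray : ∀ w w', V w → V w' → (∃ r : ℝ, w' = r • w) →
      SignType.sign (b.repr w 0) = SignType.sign (b.repr w' 0) →
      SignType.sign (b.repr w 1) = SignType.sign (b.repr w' 1) → w' = w := by
    rintro w w' hw hw' ⟨r, he⟩ hs0 hs1
    obtain ⟨i, hi, hi1⟩ := hone w hw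
    obtain ⟨j, hj, hj1⟩ := hone w' hw'
    have hcoord : ∃ l, b.repr w l ≠ 0 := by
      by_contra! hh
      exact hw.1 (b.repr.map_eq_zero_iff.1 (Finsupp.ext hh))
    have hs : ∀ l, SignType.sign (b.repr w l) = SignType.sign (b.repr w' l) := by
      intro l
      fin_cases l
      · exact hs0
      · exact hs1
    obtain ⟨l, hl⟩ := hcoord
    have hl' := hs l
    have hpos : 0 < r := by
      rw [he, map_smul, Finsupp.smul_apply, smul_eq_mul, sign_mul] at hl'
      have hne : SignType.sign (b.repr w l) ≠ 0 := sign_ne_zero.2 hl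
      rw [← sign_eq_one_iff]
      exact (mul_right_cancel₀ hne (by rw [one_mul]; exact hl')).symm
    exact eq_of_smul_vertex hw.2.2 hw'.2.2 hi hj hi1 hj1 hpos he
  -- vertices on a central wall
  have hA : #(cells x X fun w => V w ∧ ∃ i ∈ X, x i w = 0) ≤ 9 * #X := by
    have hex : ∀ w, (V w ∧ ∃ i ∈ X, x i w = 0) → ∃ i ∈ X, x i w = 0 := fun w hw => hw.2
    rcases X.eq_empty_or_nonempty with rfl | ⟨i0, hi0⟩
    · have : (cells x ∅ fun w => V w ∧ ∃ i ∈ (∅ : Finset ι), x i w = 0) = ∅ := by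
        refine eq_empty_of_forall_notMem fun σ hσ => ?_
        obtain ⟨w, ⟨-, i, hi, -⟩, -⟩ := mem_cells.1 hσ
        simp at hi
      rw [this]
      simp
    · have : Nonempty ι := ⟨i0⟩
      choose! i hi hi0 using hex
      refine (card_cells_le (fun w => (i w, SignType.sign (b.repr w 0),
        SignType.sign (b.repr w 1))) (X ×ˢ univ) (fun w hw => by simp [hi w hw]) ?_).trans ?_
      · intro w w' hw hw' he
        simp only [Prod.mk.injEq] at he
        obtain ⟨k, hk, hk1⟩ := hone w hw.1
        have hik : i w ≠ k := fun e => by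
          have := hi0 w hw
          rw [e, hk1] at this
          norm_num at this
        have hprop : w' = x k w' • w := by
          refine h.eq_of_eqOn (T := {i w, k}) ?_ (by rw [hD, card_pair hik]) fun t ht => ?_
          · intro t ht
            rcases mem_insert.1 ht with rfl | ht
            · exact hi w hw
            · rw [mem_singleton.1 ht]
              exact hk
          · rcases mem_insert.1 ht with rfl | ht
            · rw [map_smul, hi0 w hw, he.1, hi0 w' hw']
              simp
            · rw [mem_singleton.1 ht, map_smul, hk1]
              simp
        rw [hray w w' hw.1 hw'.1 ⟨_, hprop⟩ he.2.1 he.2.2]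
      · rw [card_product, mul_comm]
        exact Nat.mul_le_mul_right _ (by decide)
  -- vertices with vanishing first coordinate
  have hB : #(cells x X fun w => V w ∧ b.repr w 0 = 0) ≤ 9 := by
    refine (card_cells_le (fun w => (SignType.sign (b.repr w 0),
        SignType.sign (b.repr w 1))) univ (fun w hw => mem_univ _) ?_).trans
        (by decide)
    intro w w' hw hw' he
    simp only [Prod.mk.injEq] at he
    have h1 : b.repr w 1 ≠ 0 := fun h1 => hw.1.1 (b.repr.map_eq_zero_iff.1 (by
      ext l
      fin_cases l
      · exact hw.2
      · exact h1))
    have hprop : w' = (b.repr w' 1 / b.repr w 1) • w := by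
      apply b.repr.injective
      ext l
      rw [map_smul, Finsupp.smul_apply, smul_eq_mul]
      fin_cases l
      · simp [hw.2, hw'.2]
      · simp [h1]
    rw [hray w w' hw.1 hw'.1 ⟨_, hprop⟩ he.1 he.2]
  have hC := h.card_plane_half_le hD b (ε := 1) (by norm_num)
  have hC' := h.card_plane_half_le hD b (ε := -1) (by norm_num)
  have hmain : vertexCount x X 0 ≤ #(cells x X fun w => V w ∧ ∃ i ∈ X, x i w = 0) +
      (#(cells x X fun w => V w ∧ b.repr w 0 = 0) +
      (#(cells x X fun w => (#(tight x X w) = 2 ∧ mids x X w = ∅ ∧ ∀ i ∈ X, x i w ≠ 0) ∧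
        0 < 1 * b.repr w 0) +
      #(cells x X fun w => (#(tight x X w) = 2 ∧ mids x X w = ∅ ∧ ∀ i ∈ X, x i w ≠ 0) ∧
        0 < -1 * b.repr w 0))) := by
    refine (card_cells_mono fun w hw => ?_).trans ((card_cells_or _ _).trans
      (Nat.add_le_add_left ((card_cells_or _ _).trans
      (Nat.add_le_add_left (card_cells_or _ _) _)) _))
    have hV : V w := ⟨hw.1, hw.2.1.trans hD, by simpa using hw.2.2⟩
    by_cases hz : ∃ i ∈ X, x i w = 0
    · exact Or.inl ⟨hV, hz⟩
    · push Not at hz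
      rcases lt_trichotomy (b.repr w 0) 0 with h0 | h0 | h0
      · exact Or.inr (Or.inr (Or.inr ⟨⟨hV.2.1, hV.2.2, hz⟩, by linarith⟩))
      · exact Or.inr (Or.inl ⟨hV, h0⟩)
      · exact Or.inr (Or.inr (Or.inl ⟨⟨hV.2.1, hV.2.2, hz⟩, by linarith⟩))
  omega

end Zone

/-! ### The zone theorem -/

section ZoneInduction
variable {ι W : Type} [AddCommGroup W] [Module ℝ W]

lemma succ_pow_le_choose {m k : ℕ} (h : k ≤ m) :
    (m + 1) ^ k ≤ ((k + 1) ^ k * k.factorial) * m.choose k := by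
  have h1 : (m + 1 - k) ^ k ≤ k.factorial * m.choose k := by
    have := Nat.pow_le_choose (α := ℚ) k m
    rw [div_le_iff₀ (by positivity)] at this
    have h2 : (((m + 1 - k) ^ k : ℕ) : ℚ) ≤ ((m.choose k * k.factorial : ℕ) : ℚ) := by
      push_cast
      exact_mod_cast this
    rw [mul_comm]
    exact_mod_cast h2
  have h2 : m + 1 ≤ (k + 1) * (m + 1 - k) := by
    obtain ⟨e, rfl⟩ := Nat.exists_eq_add_of_le h
    have : k + e + 1 - k = e + 1 := by omega
    rw [this]
    nlinarith [Nat.zero_le (k * e)]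
  calc (m + 1) ^ k ≤ ((k + 1) * (m + 1 - k)) ^ k := Nat.pow_le_pow_left h2 k
    _ = (k + 1) ^ k * (m + 1 - k) ^ k := mul_pow _ _ _
    _ ≤ (k + 1) ^ k * (k.factorial * m.choose k) := Nat.mul_le_mul_left _ h1
    _ = _ := by ring

lemma faceCount_eq_zero [Fintype ι] {x : ι → Dual ℝ W} {X : Finset ι} {k : ℕ} (h : #X < k) :
    faceCount x X k = 0 := by
  refine card_eq_zero.2 (eq_empty_of_forall_notMem fun σ hσ => ?_)
  obtain ⟨w, ⟨hw, -⟩, -⟩ := mem_cells.1 hσ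
  have : #(tight x X w) ≤ #X := card_le_card fun i hi => (mem_tight.1 hi).1
  omega

/-- Faces of codimension at most `dim W - 2` are counted by deleting one functional at a time; the
faces on its central wall belong to an arrangement in one dimension less. Normalising by
`(#X).choose k` turns the recursion into a sum of powers of `#X`, without a logarithm. -/
lemma GenPos.faceCount_le_choose [Fintype ι] [FiniteDimensional ℝ W] {x : ι → Dual ℝ W}
    {n k K : ℕ} (hD : finrank ℝ W = n + 3) (hk : k ≤ n + 1)
    (hK : ∀ q, x q ≠ 0 → ∀ Y, GenPos (restrictWall x q) Y →
      faceCount (restrictWall x q) Y k ≤ K * (#Y + 1) ^ (n + 1)) :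
    ∀ m, ∀ X : Finset ι, #X = m → GenPos x X → k ≤ m → faceCount x X k ≤ m.choose k *
      (9 ^ (n + 3) + K * ((k + 1) ^ k * k.factorial) * (m + 1) ^ (n + 2 - k)) := by
  classical
  intro m
  induction m with
  | zero =>
    intro X hX h hkm
    have := card_cells_le_pow x X fun w => #(tight x X w) = k ∧ mids x X w = ∅
    obtain rfl : k = 0 := by omega
    rw [hX, pow_zero] at this
    refine this.trans ?_
    simp only [Nat.choose_self, one_mul]
    exact (Nat.one_le_pow _ _ (by norm_num)).trans (Nat.le_add_right _ _)
  | succ m ih =>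
    intro X hX h hkm
    set A := (k + 1) ^ k * k.factorial
    rcases lt_or_ge (m + 1) (n + 3) with hm | hm
    · have := card_cells_le_pow x X fun w => #(tight x X w) = k ∧ mids x X w = ∅
      rw [hX] at this
      have h1 : 1 ≤ (m + 1).choose k := Nat.choose_pos hkm
      calc faceCount x X k ≤ 9 ^ (m + 1) := this
        _ ≤ 9 ^ (n + 3) := Nat.pow_le_pow_right (by norm_num) hm.le
        _ ≤ 1 * (9 ^ (n + 3) + K * A * (m + 1 + 1) ^ (n + 2 - k)) := by
          rw [one_mul]
          exact Nat.le_add_right _ _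
        _ ≤ _ := Nat.mul_le_mul_right _ h1
    · have hdel := sub_mul_faceCount_le x X k
      have hterm : ∀ q ∈ X, faceCount x (X.erase q) k + faceCount (restrictWall x q) (X.erase q) k
          ≤ m.choose k * (9 ^ (n + 3) + K * A * (m + 2) ^ (n + 2 - k)) := by
        intro q hq
        have hc : #(X.erase q) = m := by rw [card_erase_of_mem hq, hX]; rfl
        have hq0 : x q ≠ 0 := h.apply_ne_zero (by omega) (by omega) hq
        have h1 := ih (X.erase q) hc (h.subset (erase_subset _ _)) (by omega)
        have h2 := hK q hq0 _ (h.restrict_ker hq hq0)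
        rw [hc] at h2
        have h3 : (m + 1) ^ (n + 1) ≤ A * m.choose k * (m + 1) ^ (n + 1 - k) := by
          calc (m + 1) ^ (n + 1) = (m + 1) ^ k * (m + 1) ^ (n + 1 - k) := by
                rw [← pow_add]; congr 1; omega
            _ ≤ _ := Nat.mul_le_mul_right _ (succ_pow_le_choose (by omega))
        have h4 : (m + 1) ^ (n + 2 - k) + (m + 1) ^ (n + 1 - k) ≤ (m + 2) ^ (n + 2 - k) := by
          have e : n + 2 - k = (n + 1 - k) + 1 := by omega
          rw [e]
          calc (m + 1) ^ (n + 1 - k + 1) + (m + 1) ^ (n + 1 - k)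
              = (m + 1) ^ (n + 1 - k) * (m + 2) := by ring
            _ ≤ (m + 2) ^ (n + 1 - k) * (m + 2) :=
              Nat.mul_le_mul_right _ (Nat.pow_le_pow_left (by omega) _)
            _ = _ := by ring
        calc _ ≤ m.choose k * (9 ^ (n + 3) + K * A * (m + 1) ^ (n + 2 - k)) +
              K * (A * m.choose k * (m + 1) ^ (n + 1 - k)) :=
              add_le_add h1 (h2.trans (Nat.mul_le_mul_left _ h3))
          _ = m.choose k * (9 ^ (n + 3) + K * A *
              ((m + 1) ^ (n + 2 - k) + (m + 1) ^ (n + 1 - k))) := by ring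
          _ ≤ _ := by gcongr
      have hsum := sum_le_card_nsmul X _ _ hterm
      rw [hX, smul_eq_mul] at hsum
      rw [hX] at hdel
      have hpos : 0 < m + 1 - k := by omega
      refine Nat.le_of_mul_le_mul_left ?_ hpos
      calc _ ≤ (m + 1) * (m.choose k * (9 ^ (n + 3) + K * A * (m + 2) ^ (n + 2 - k))) :=
            hdel.trans hsum
        _ = m.choose k * (m + 1) * (9 ^ (n + 3) + K * A * (m + 2) ^ (n + 2 - k)) := by ring
        _ = _ := by rw [Nat.choose_mul_succ_eq]; ring

/-- Away from the space between the pairs of walls there are `O(m ^ (dim W - 1))` vertices: the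
zone theorem, for vertices that see the hyperplane at the origin along a ray. -/
theorem exists_vertexCount_zero_le (n : ℕ) : ∃ K : ℕ, ∀ (ι W : Type) [Fintype ι]
    [AddCommGroup W] [Module ℝ W] [FiniteDimensional ℝ W] (x : ι → Dual ℝ W) (X : Finset ι),
    finrank ℝ W = n + 2 → GenPos x X → vertexCount x X 0 ≤ K * (#X + 1) ^ (n + 1) := by
  induction n with
  | zero =>
    refine ⟨15, ?_⟩
    intro ι W _ _ _ _ x X hD h
    rw [zero_add, pow_one]
    exact h.vertexCount_zero_le_of_finrank_two hD
  | succ n ih =>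
    obtain ⟨K, hK⟩ := ih
    let K₁ := K * 3 ^ (n + 2) + 2 + 9 ^ (n + 2)
    let B : ℕ → ℕ := fun k => 9 ^ (n + 3) + K₁ * ((k + 1) ^ k * k.factorial)
    refine ⟨2 * ∑ k ∈ range ((n + 3) / 2 + 1), B k, ?_⟩
    intro ι W _ _ _ _ x X hD h
    have hface : ∀ k ≤ n + 1, faceCount x X k ≤ B k * (#X + 1) ^ (n + 2) := by
      intro k hk
      rcases lt_or_ge #X k with hX | hX
      · rw [faceCount_eq_zero hX]
        exact Nat.zero_le _
      · have hrec : ∀ q, x q ≠ 0 → ∀ Y, GenPos (restrictWall x q) Y →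
            faceCount (restrictWall x q) Y k ≤ K₁ * (#Y + 1) ^ (n + 1) := by
          intro q hq Y hY
          have hd : finrank ℝ (LinearMap.ker (x q)) = n + 2 := by
            have := finrank_ker_add_one hq
            omega
          have h1 := hY.card_cells_mids_le (by omega) 0
          rw [hd] at h1
          have h2 := hK ι _ (restrictWall x q) Y hd hY
          have h3 : 1 ≤ (#Y + 1) ^ (n + 1) := Nat.one_le_pow _ _ (by omega)
          have h4 : faceCount (restrictWall x q) Y k ≤
              #(cells (restrictWall x q) Y fun w => #(mids (restrictWall x q) Y w) ≤ 0) :=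
            card_cells_mono fun w hw => by simp [hw.2]
          have e : n + 2 - 1 = n + 1 := rfl
          rw [e] at h1
          calc _ ≤ _ := h4.trans h1
            _ ≤ K * (#Y + 1) ^ (n + 1) * 3 ^ (n + 2) + ((#Y + 1) ^ (n + 1) + (#Y + 1) ^ (n + 1)) +
                9 ^ (n + 2) * (#Y + 1) ^ (n + 1) := by
              gcongr
              exact Nat.le_mul_of_pos_right _ h3
            _ = _ := by
              simp only [K₁]
              ring
        have h1 := GenPos.faceCount_le_choose hD hk hrec #X X rfl h hX
        have h3 : 1 ≤ (#X + 1) ^ (n + 2 - k) := Nat.one_le_pow _ _ (by omega)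
        calc _ ≤ _ := h1
          _ ≤ (#X + 1) ^ k * (9 ^ (n + 3) * (#X + 1) ^ (n + 2 - k) +
              K₁ * ((k + 1) ^ k * k.factorial) * (#X + 1) ^ (n + 2 - k)) := by
            gcongr
            · exact (Nat.choose_le_pow _ _).trans (Nat.pow_le_pow_left (by omega) _)
            · exact Nat.le_mul_of_pos_right _ h3
          _ = B k * ((#X + 1) ^ k * (#X + 1) ^ (n + 2 - k)) := by
            simp only [B]
            ring
          _ = _ := by
            rw [← pow_add]
            congr 2
            omega
    have hD' : finrank ℝ W = n + 3 := hD
    have hv := h.vertexCount_zero_le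
    rw [hD'] at hv
    refine hv.trans ?_
    rw [mul_assoc, sum_mul]
    refine Nat.mul_le_mul_left _ (sum_le_sum fun k hk => hface k ?_)
    rw [mem_range] at hk
    omega

end ZoneInduction

/-! ### Random samples -/

section Sampling
variable {ι : Type} [DecidableEq ι]

/-- The expectation of `f Y` for a random subset `Y` of `X` that contains each element
independently with probability `p`. -/
def sampleMean (p : ℝ) (X : Finset ι) (f : Finset ι → ℝ) : ℝ :=
  ∑ Y ∈ X.powerset, p ^ #Y * (1 - p) ^ #(X \ Y) * f Y

lemma sampleMean_mono {p : ℝ} (h0 : 0 ≤ p) (h1 : p ≤ 1) {X : Finset ι} {f g : Finset ι → ℝ}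
    (h : ∀ Y ⊆ X, f Y ≤ g Y) : sampleMean p X f ≤ sampleMean p X g :=
  sum_le_sum fun Y hY => mul_le_mul_of_nonneg_left (h Y (mem_powerset.1 hY))
    (mul_nonneg (pow_nonneg h0 _) (pow_nonneg (sub_nonneg.2 h1) _))

lemma sampleMean_sum {β : Type*} (p : ℝ) (X : Finset ι) (s : Finset β)
    (f : β → Finset ι → ℝ) :
    sampleMean p X (fun Y => ∑ b ∈ s, f b Y) = ∑ b ∈ s, sampleMean p X (f b) := by
  simp only [sampleMean, mul_sum]
  exact sum_comm

lemma sampleMean_mul_left (p : ℝ) (X : Finset ι) (c : ℝ) (f : Finset ι → ℝ) :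
    sampleMean p X (fun Y => c * f Y) = c * sampleMean p X f := by
  simp only [sampleMean, mul_sum]
  exact sum_congr rfl fun Y _ => by ring

lemma sampleMean_add (p : ℝ) (X : Finset ι) (f g : Finset ι → ℝ) :
    sampleMean p X (fun Y => f Y + g Y) = sampleMean p X f + sampleMean p X g := by
  simp only [sampleMean, ← sum_add_distrib]
  exact sum_congr rfl fun Y _ => by ring

/-- The probability that the sample contains `T` and avoids `M`. -/
lemma sampleMean_subset_disjoint (p : ℝ) {X T M : Finset ι} (hT : T ⊆ X) (hM : M ⊆ X)
    (hTM : Disjoint T M) :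
    sampleMean p X (fun Y => if T ⊆ Y ∧ Disjoint Y M then 1 else 0) =
      p ^ #T * (1 - p) ^ #M := by
  have key := prod_add (fun i => if i ∈ M then 0 else p) (fun i => if i ∈ T then 0 else 1 - p) X
  have hl : ∏ i ∈ X, ((if i ∈ M then 0 else p) + (if i ∈ T then 0 else 1 - p)) =
      p ^ #T * (1 - p) ^ #M := by
    rw [← prod_const, ← prod_const, ← inter_eq_right.2 hT, ← inter_eq_right.2 hM,
      ← prod_ite_mem, ← prod_ite_mem, ← prod_mul_distrib, inter_eq_right.2 hT, inter_eq_right.2 hM]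
    refine prod_congr rfl fun i _ => ?_
    by_cases h1 : i ∈ T
    · have := disjoint_left.1 hTM h1
      simp [h1, this]
    · by_cases h2 : i ∈ M <;> simp [h1, h2]
  rw [← hl, key, sampleMean]
  refine sum_congr rfl fun Y hY => ?_
  have hYX := mem_powerset.1 hY
  split_ifs with h
  · rw [mul_one, ← prod_const, ← prod_const]
    congr 1
    · exact prod_congr rfl fun i hi => (if_neg (disjoint_left.1 h.2 hi)).symm
    · refine prod_congr rfl fun i hi => (if_neg fun hh => ?_).symm
      exact (mem_sdiff.1 hi).2 (h.1 hh)
  · rw [mul_zero, eq_comm, mul_eq_zero]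
    by_cases hTY : T ⊆ Y
    · have : ¬ Disjoint Y M := fun hh => h ⟨hTY, hh⟩
      obtain ⟨i, hi, hiM⟩ := not_disjoint_iff.1 this
      exact Or.inl (prod_eq_zero hi (if_pos hiM))
    · obtain ⟨i, hi, hiY⟩ := not_subset.1 hTY
      exact Or.inr (prod_eq_zero (mem_sdiff.2 ⟨hT hi, hiY⟩) (if_pos hi))

lemma sampleMean_subset (p : ℝ) {X T : Finset ι} (hT : T ⊆ X) :
    sampleMean p X (fun Y => if T ⊆ Y then 1 else 0) = p ^ #T := by
  have := sampleMean_subset_disjoint p hT (empty_subset X) (disjoint_empty_right T)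
  simpa using this

lemma sampleMean_const (p : ℝ) (X : Finset ι) (c : ℝ) : sampleMean p X (fun _ => c) = c := by
  have := sampleMean_subset p (empty_subset X)
  simp only [empty_subset, if_true, card_empty, pow_zero] at this
  have h2 := sampleMean_mul_left p X c (fun _ => 1)
  rw [this] at h2
  simpa using h2

lemma sampleMean_choose (p : ℝ) (X : Finset ι) (j : ℕ) :
    sampleMean p X (fun Y => ((#Y).choose j : ℝ)) = (#X).choose j * p ^ j := by
  have h1 : ∀ Y ⊆ X, ((#Y).choose j : ℝ) =
      ∑ T ∈ X.powersetCard j, if T ⊆ Y then (1 : ℝ) else 0 := by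
    intro Y hY
    rw [sum_boole, ← card_powersetCard]
    congr 2
    ext T
    simp only [mem_powersetCard, mem_filter]
    constructor
    · rintro ⟨h1, h2⟩
      exact ⟨⟨h1.trans hY, h2⟩, h1⟩
    · rintro ⟨⟨-, h2⟩, h1⟩
      exact ⟨h1, h2⟩
  calc sampleMean p X (fun Y => ((#Y).choose j : ℝ))
      = sampleMean p X (fun Y => ∑ T ∈ X.powersetCard j, if T ⊆ Y then (1 : ℝ) else 0) :=
        sum_congr rfl fun Y hY => congrArg _ (h1 Y (mem_powerset.1 hY))
    _ = ∑ T ∈ X.powersetCard j, p ^ j := by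
        rw [sampleMean_sum]
        refine sum_congr rfl fun T hT => ?_
        obtain ⟨h2, h3⟩ := mem_powersetCard.1 hT
        rw [sampleMean_subset p h2, h3]
    _ = _ := by rw [sum_const, card_powersetCard, nsmul_eq_mul]

/-- The moments of the sample size are those of its mean, up to a constant. -/
lemma sampleMean_pow_le {p : ℝ} (h0 : 0 ≤ p) (h1 : p ≤ 1) (X : Finset ι) (j : ℕ) :
    sampleMean p X (fun Y => ((#Y + 1 : ℝ)) ^ j) ≤
      2 * ((j + 1) ^ j * j.factorial : ℕ) * (p * #X + 1) ^ j := by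
  set A : ℕ := (j + 1) ^ j * j.factorial
  have hle : ∀ n : ℕ, ((n + 1 : ℝ)) ^ j ≤ A * (1 + n.choose j) := by
    intro n
    have : (n + 1) ^ j ≤ A * (1 + n.choose j) := by
      rcases le_or_gt j n with h | h
      · exact (succ_pow_le_choose h).trans (Nat.mul_le_mul_left _ (Nat.le_add_left _ _))
      · calc (n + 1) ^ j ≤ (j + 1) ^ j := Nat.pow_le_pow_left (by omega) _
          _ ≤ A := Nat.le_mul_of_pos_right _ (Nat.factorial_pos _)
          _ ≤ _ := Nat.le_mul_of_pos_right _ (by omega)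
    exact_mod_cast this
  have hA : (0 : ℝ) ≤ A := Nat.cast_nonneg _
  have hm : (0 : ℝ) ≤ p * #X := mul_nonneg h0 (Nat.cast_nonneg _)
  calc _ ≤ sampleMean p X (fun Y => A * (1 + ((#Y).choose j : ℝ))) :=
        sampleMean_mono h0 h1 fun Y _ => hle #Y
    _ = A * (1 + (#X).choose j * p ^ j) := by
        rw [sampleMean_mul_left, sampleMean_add, sampleMean_const, sampleMean_choose]
    _ ≤ A * ((p * #X + 1) ^ j + (p * #X + 1) ^ j) := by
        refine mul_le_mul_of_nonneg_left (add_le_add (one_le_pow₀ (by linarith)) ?_) hA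
        calc ((#X).choose j : ℝ) * p ^ j ≤ (#X : ℝ) ^ j * p ^ j := by
              gcongr
              exact_mod_cast Nat.choose_le_pow _ _
          _ = (p * #X) ^ j := by rw [mul_pow, mul_comm]
          _ ≤ _ := pow_le_pow_left₀ hm (by linarith) j
    _ = _ := by ring

end Sampling

section ShallowCells
variable {ι W : Type} [AddCommGroup W] [Module ℝ W]

/-- A vertex survives in a sample as an outer vertex as soon as the sample contains the
functionals that define it and misses those between whose walls it lies. -/
lemma GenPos.vertexCount_mul_le [Fintype ι] [DecidableEq ι] {x : ι → Dual ℝ W}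
    {X : Finset ι} (h : GenPos x X) (r : ℕ) {p : ℝ} (h0 : 0 ≤ p) (h1 : p ≤ 1) :
    vertexCount x X r * (p ^ finrank ℝ W * (1 - p) ^ r) ≤
      sampleMean p X (fun Y => vertexCount x Y 0) := by
  classical
  obtain ⟨S, hS, hP⟩ := exists_representatives x X fun w =>
    w ≠ 0 ∧ #(tight x X w) = finrank ℝ W ∧ #(mids x X w) ≤ r
  have hS' : #S = vertexCount x X r := hS
  have hsub : ∀ Y ⊆ X, ((∑ w ∈ S, if tight x X w ⊆ Y ∧ Disjoint Y (mids x X w) then 1 else 0 : ℝ))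
      ≤ vertexCount x Y 0 := by
    intro Y hY
    rw [sum_boole]
    have ht : ∀ w, tight x X w ⊆ Y → tight x Y w = tight x X w := by
      intro w hw
      ext i
      rw [mem_tight]
      constructor
      · rintro ⟨a, b⟩
        exact mem_tight.2 ⟨hY a, b⟩
      · intro hi
        exact ⟨hw hi, (mem_tight.1 hi).2⟩
    have : #(S.filter fun w => tight x X w ⊆ Y ∧ Disjoint Y (mids x X w)) ≤ vertexCount x Y 0 := by
      refine card_le_card_of_injOn (cell x Y) (fun w hw => ?_) fun w hw w' hw' he => ?_
      · obtain ⟨hw, h2, h3⟩ := mem_filter.1 hw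
        refine mem_cells.2 ⟨w, ⟨(hP w hw).1, ?_, ?_⟩, rfl⟩
        · rw [ht w h2]
          exact (hP w hw).2.1
        · rw [Nat.le_zero, card_eq_zero]
          refine eq_empty_of_forall_notMem fun i hi => ?_
          obtain ⟨a, b⟩ := mem_mids.1 hi
          exact disjoint_left.1 h3 a (mem_mids.2 ⟨hY a, b⟩)
      · obtain ⟨hw, h2, h3⟩ := mem_filter.1 hw
        refine h.eq_of_eqOn (h2.trans hY) (hP w hw).2.1.ge fun t htt => ?_
        obtain ⟨-, e2, e3, -⟩ := wallSign_eq_iff.1 (cell_eq_iff.1 he t (h2 htt))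
        rcases (mem_tight.1 htt).2 with e | e
        · rw [e, e2.1 e]
        · rw [e, e3.1 e]
    exact_mod_cast this
  refine le_trans ?_ (sampleMean_mono h0 h1 hsub)
  rw [sampleMean_sum, ← hS', ← nsmul_eq_mul]
  refine card_nsmul_le_sum S _ _ fun w hw => ?_
  have hd : Disjoint (tight x X w) (mids x X w) := disjoint_left.2 fun i hi hi' => by
    rw [mem_tight] at hi
    rw [mem_mids] at hi'
    grind
  rw [sampleMean_subset_disjoint p (fun i hi => (mem_tight.1 hi).1)
    (fun i hi => (mem_mids.1 hi).1) hd, (hP w hw).2.1]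
  exact mul_le_mul_of_nonneg_left (pow_le_pow_of_le_one (by linarith) (by linarith)
    (hP w hw).2.2) (pow_nonneg h0 _)

/-- Clarkson–Shor: passing from the outer vertices to those between at most `r` pairs of walls
costs only a factor `r + 1`. -/
theorem exists_vertexCount_le (n : ℕ) : ∃ K : ℝ, 0 ≤ K ∧ ∀ (ι W : Type) [Fintype ι]
    [AddCommGroup W] [Module ℝ W] [FiniteDimensional ℝ W] (x : ι → Dual ℝ W) (X : Finset ι)
    (r : ℕ), finrank ℝ W = n + 2 → GenPos x X →
    (vertexCount x X r : ℝ) ≤ K * ((r + 1) * (#X + 1) ^ (n + 1)) := by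
  obtain ⟨K, hK⟩ := exists_vertexCount_zero_le n
  set A : ℕ := (n + 1 + 1) ^ (n + 1) * (n + 1).factorial with hA
  refine ⟨4 * 3 ^ (n + 1) * (K * (2 * A)), by positivity, ?_⟩
  intro ι W _ _ _ _ x X r hD h
  classical
  -- the claim for `r ≤ #X`; larger values of `r` give nothing new
  have main : ∀ r ≤ #X, (vertexCount x X r : ℝ) ≤
      4 * 3 ^ (n + 1) * (K * (2 * A)) * ((r + 1) * (#X + 1) ^ (n + 1)) := by
    intro r hr
    -- at the sampling rate `1 / s`, none of `r` elements is sampled with probability at least `1 / 2`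
    set s : ℝ := 2 * (r + 1) with hs
    have hs0 : 0 < s := by positivity
    have hp0 : 0 ≤ 1 / s := by positivity
    have hp1 : 1 / s ≤ 1 := by
      rw [div_le_one hs0, hs]
      have : (0 : ℝ) ≤ r := Nat.cast_nonneg r
      linarith
    have h1 := h.vertexCount_mul_le r hp0 hp1
    rw [hD] at h1
    have h2 : sampleMean (1 / s) X (fun Y => (vertexCount x Y 0 : ℝ)) ≤
        K * (2 * A * (1 / s * #X + 1) ^ (n + 1)) := by
      calc _ ≤ sampleMean (1 / s) X (fun Y => K * ((#Y + 1 : ℝ)) ^ (n + 1)) :=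
            sampleMean_mono hp0 hp1 fun Y hY => by
              exact_mod_cast hK ι W x Y hD (h.subset hY)
        _ ≤ _ := by
            rw [sampleMean_mul_left]
            exact mul_le_mul_of_nonneg_left (sampleMean_pow_le hp0 hp1 X (n + 1))
              (Nat.cast_nonneg _)
    have h3 : 1 / 2 ≤ (1 - 1 / s) ^ r := by
      have hb := one_add_mul_le_pow (a := -(1 / s)) (by linarith) r
      have : (r : ℝ) * (1 / s) ≤ 1 / 2 := by
        rw [mul_one_div, div_le_div_iff₀ hs0 (by norm_num), hs]
        linarith
      rw [← sub_eq_add_neg] at hb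
      linarith
    have h4 : (vertexCount x X r : ℝ) * ((1 / s) ^ (n + 2) * (1 / 2)) ≤
        K * (2 * A * (1 / s * #X + 1) ^ (n + 1)) :=
      le_trans (by gcongr) (h1.trans h2)
    have h5 : (1 / s * #X + 1) ^ (n + 1) = (1 / s) ^ (n + 1) * (#X + s) ^ (n + 1) := by
      rw [← mul_pow]
      congr 1
      field_simp
    have h6 : (#X + s : ℝ) ^ (n + 1) ≤ 3 ^ (n + 1) * (#X + 1) ^ (n + 1) := by
      rw [← mul_pow]
      have : (r : ℝ) ≤ #X := by exact_mod_cast hr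
      exact pow_le_pow_left₀ (by positivity) (by rw [hs]; linarith) _
    have h7 : (vertexCount x X r : ℝ) ≤ 2 * s * (K * (2 * A * (#X + s) ^ (n + 1))) := by
      rw [h5] at h4
      have hpos : 0 < (1 / s) ^ (n + 2) * (1 / 2) := by positivity
      refine le_of_mul_le_mul_right (h4.trans (le_of_eq ?_)) hpos
      rw [pow_succ (1 / s) (n + 1)]
      field_simp
    calc (vertexCount x X r : ℝ) ≤ _ := h7
      _ ≤ 2 * s * (K * (2 * A * (3 ^ (n + 1) * (#X + 1) ^ (n + 1)))) := by gcongr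
      _ = _ := by rw [hs]; ring
  rcases le_or_gt r #X with hr | hr
  · exact main r hr
  · have e : vertexCount x X r ≤ vertexCount x X #X := card_cells_mono fun w hw =>
      ⟨hw.1, hw.2.1, card_le_card fun i hi => (mem_mids.1 hi).1⟩
    calc (vertexCount x X r : ℝ) ≤ vertexCount x X #X := by exact_mod_cast e
      _ ≤ _ := main _ le_rfl
      _ ≤ _ := by gcongr

/-- At most `O(r m ^ (dim W - 1))` cells lie between at most `r` pairs of walls. -/
theorem exists_card_cells_le (n : ℕ) : ∃ K : ℝ, 0 ≤ K ∧ ∀ (ι W : Type) [Fintype ι]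
    [AddCommGroup W] [Module ℝ W] [FiniteDimensional ℝ W] (x : ι → Dual ℝ W) (X : Finset ι)
    (r : ℕ), finrank ℝ W = n + 2 → GenPos x X →
    (#(cells x X fun w => #(mids x X w) ≤ r) : ℝ) ≤ K * ((r + 1) * (#X + 1) ^ (n + 1)) := by
  obtain ⟨K, hK0, hK⟩ := exists_vertexCount_le n
  refine ⟨K * 3 ^ (n + 2) + 2 + 9 ^ (n + 2), by positivity, ?_⟩
  intro ι W _ _ _ _ x X r hD h
  have h1 := h.card_cells_mids_le (by omega) r
  rw [hD] at h1
  have h2 := hK ι W x X r hD h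
  have e : n + 2 - 1 = n + 1 := rfl
  rw [e] at h1
  have h1' : (#(cells x X fun w => #(mids x X w) ≤ r) : ℝ) ≤
      vertexCount x X r * 3 ^ (n + 2) + ((#X + 1) ^ (n + 1) + 1) + 9 ^ (n + 2) := by
    exact_mod_cast h1
  set Q : ℝ := (r + 1) * (#X + 1) ^ (n + 1) with hQ
  have hq : ((#X : ℝ) + 1) ^ (n + 1) ≤ Q := by
    rw [hQ]
    have : (0 : ℝ) ≤ r := Nat.cast_nonneg r
    exact le_mul_of_one_le_left (by positivity) (by linarith)
  have hq1 : 1 ≤ Q := (one_le_pow₀ (by linarith [(Nat.cast_nonneg #X : (0 : ℝ) ≤ #X)])).trans hq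
  calc _ ≤ _ := h1'
    _ ≤ K * Q * 3 ^ (n + 2) + (Q + Q) + 9 ^ (n + 2) * Q := by
      gcongr
      exact le_mul_of_one_le_right (by positivity) hq1
    _ = _ := by ring

end ShallowCells

/-! ### General position by perturbation -/

section Perturbation
variable {ι W : Type} [AddCommGroup W] [Module ℝ W]

lemma eq_zero_of_linearIndepOn [FiniteDimensional ℝ W] {x : ι → Dual ℝ W} {T : Finset ι}
    (h : LinearIndepOn ℝ x (T : Set ι)) (hT : #T = finrank ℝ W) {v : W}
    (hv : ∀ t ∈ T, x t v = 0) : v = 0 := by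
  have hspan : Submodule.span ℝ (Set.range fun t : T => x t) = ⊤ :=
    LinearIndependent.span_eq_top_of_card_eq_finrank' (b := fun t : T => x t) h
      (by rw [Fintype.card_coe, hT, Subspace.dual_finrank_eq])
  rw [← Module.forall_dual_apply_eq_zero_iff ℝ]
  intro f
  have hf : f ∈ Submodule.span ℝ (Set.range fun t : T => x t) := by
    rw [hspan]
    trivial
  induction hf using Submodule.span_induction with
  | mem f hf =>
    obtain ⟨t, rfl⟩ := hf
    exact hv t t.2
  | zero => rfl
  | add f g _ _ hf hg => rw [LinearMap.add_apply, hf, hg, add_zero]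
  | smul c f _ hf => rw [LinearMap.smul_apply, hf, smul_zero]

/-- Moving a functional slightly makes it avoid the values `0` and `1` at finitely many given
nonzero points. -/
lemma exists_dual_near_avoiding (f : Dual ℝ W) (E Θ : Finset W) (hE : ∀ w ∈ E, w ≠ 0)
    {η : ℝ} (hη : 0 < η) :
    ∃ g : Dual ℝ W, (∀ w ∈ E, g w ≠ 0 ∧ g w ≠ 1) ∧ ∀ θ ∈ Θ, |g θ - f θ| < η := by
  obtain ⟨y, hy⟩ := Module.exists_dual_forall_apply_ne_zero (K := ℝ)
    (fun w : E => (w : W)) fun w => hE w w.2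
  have hne : ∀ w ∈ E, ∀ c : ℝ, ∀ᶠ s : ℝ in nhdsWithin 0 {0}ᶜ, f w + s * y w ≠ c := by
    intro w hw c
    have hyw : y w ≠ 0 := hy ⟨w, hw⟩
    have h1 : ∀ᶠ s : ℝ in nhdsWithin 0 {0}ᶜ, s ≠ (c - f w) / y w := by
      rcases eq_or_ne ((c - f w) / y w) 0 with h0 | h0
      · rw [h0]
        exact self_mem_nhdsWithin
      · exact eventually_nhdsWithin_of_eventually_nhds (eventually_ne_nhds h0.symm)
    refine h1.mono fun s hs he => hs ?_
    rw [eq_div_iff hyw]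
    linarith
  have hall : ∀ᶠ s : ℝ in nhdsWithin 0 {0}ᶜ,
      (∀ w ∈ E, f w + s * y w ≠ 0 ∧ f w + s * y w ≠ 1) ∧ ∀ θ ∈ Θ, |s * y θ| < η := by
    refine Filter.Eventually.and ((Finset.eventually_all E).2 fun w hw =>
      (hne w hw 0).and (hne w hw 1)) ((Finset.eventually_all Θ).2 fun θ _ => ?_)
    have hc : Filter.Tendsto (fun s : ℝ => |s * y θ|) (nhdsWithin 0 {0}ᶜ) (nhds 0) := by
      refine Filter.Tendsto.mono_left ?_ nhdsWithin_le_nhds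
      have : Continuous fun s : ℝ => |s * y θ| := by fun_prop
      simpa using this.tendsto 0
    exact hc.eventually_lt_const hη
  obtain ⟨s, hs, hs'⟩ := hall.exists
  exact ⟨f + s • y, fun w hw => by simpa using hs w hw, fun θ hθ => by simpa using hs' θ hθ⟩

/-- Functionals can be moved into general position by an arbitrarily small perturbation. -/
lemma exists_genPos_near [FiniteDimensional ℝ W] (x : ι → Dual ℝ W) (Θ : Finset W)
    (Y : Finset ι) {η : ℝ} (hη : 0 < η) :
    ∃ x' : ι → Dual ℝ W, GenPos x' Y ∧ ∀ i, ∀ θ ∈ Θ, |x' i θ - x i θ| < η := by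
  classical
  suffices H : ∃ x' : ι → Dual ℝ W, ((∀ R ⊆ Y, #R ≤ finrank ℝ W →
      LinearIndepOn ℝ x' (R : Set ι)) ∧ ∀ w ≠ 0, #(tight x' Y w) ≤ finrank ℝ W) ∧
      ∀ i, ∀ θ ∈ Θ, |x' i θ - x i θ| < η by
    obtain ⟨x', ⟨h1, h2⟩, h3⟩ := H
    refine ⟨x', fun w hw => ⟨?_, h2 w hw⟩, h3⟩
    by_contra! hh
    obtain ⟨T, hT, hc⟩ := exists_subset_card_eq hh
    exact hw (eq_zero_of_linearIndepOn (h1 T (hT.trans (filter_subset _ _)) hc.le) hc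
      fun t ht => (mem_filter.1 (hT ht)).2)
  induction Y using Finset.induction_on with
  | empty =>
    refine ⟨x, ⟨fun R hR _ => ?_, fun w _ => by simp [tight]⟩, fun i θ _ => by simpa using hη⟩
    rw [subset_empty.1 hR, coe_empty]
    exact linearIndepOn_empty ℝ x
  | insert i Y hi ih =>
    obtain ⟨x', ⟨h1, h2⟩, h3⟩ := ih
    -- directions killed by few functionals, and points that already lie on `dim W` walls
    have hu : ∀ R : Finset ι, #R < finrank ℝ W → ∃ u : W, u ≠ 0 ∧ ∀ t ∈ R, x' t u = 0 :=
      fun R hR => exists_ne_zero_of_card_lt x' R hR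
    choose! u hu0 hu using hu
    let Q : Finset ι × Finset ι → W → Prop := fun p w =>
      w ≠ 0 ∧ (∀ t ∈ p.1, x' t w = 0) ∧ ∀ t ∈ p.2, x' t w = 1
    have hz : ∀ p, (∃ w, Q p w) → ∃ w, Q p w := fun _ h => h
    choose! z hz using hz
    let E : Finset W := (Y.powerset.image u ∪ (Y.powerset ×ˢ Y.powerset).image z).filter (· ≠ 0)
    obtain ⟨g, hg, hg'⟩ := exists_dual_near_avoiding (x i) E Θ (fun w hw => (mem_filter.1 hw).2) hη
    let x'' := Function.update x' i g
    have hxi : x'' i = g := Function.update_self _ _ _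
    have hxt : ∀ t ∈ Y, x'' t = x' t := fun t ht => Function.update_of_ne
      (fun (e : t = i) => hi (e ▸ ht)) _ _
    refine ⟨x'', ⟨fun R hR hc => ?_, fun w hw => ?_⟩, fun j θ hθ => ?_⟩
    · have hon : ∀ R' ⊆ Y, #R' ≤ finrank ℝ W → LinearIndepOn ℝ x'' (R' : Set ι) := by
        intro R' hR' hc'
        exact (h1 R' hR' hc').congr fun t ht => (hxt t (hR' ht)).symm
      by_cases hiR : i ∈ R
      · have hR' : R.erase i ⊆ Y := fun t ht => by
          obtain ⟨a, b⟩ := mem_erase.1 ht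
          exact (mem_insert.1 (hR b)).resolve_left a
        have hc' : #(R.erase i) < finrank ℝ W := by
          have := card_erase_add_one hiR
          omega
        rw [← insert_erase hiR, coe_insert, linearIndepOn_insert (by simp)]
        refine ⟨hon _ hR' hc'.le, fun hmem => ?_⟩
        have hkill : ∀ f ∈ Submodule.span ℝ (x'' '' (R.erase i : Finset ι)),
            f (u (R.erase i)) = 0 := by
          intro f hf
          induction hf using Submodule.span_induction with
          | mem f hf =>
            obtain ⟨t, ht, rfl⟩ := hf
            rw [hxt t (hR' ht)]
            exact hu _ hc' t ht
          | zero => rfl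
          | add f g _ _ hf hg => rw [LinearMap.add_apply, hf, hg, add_zero]
          | smul c f _ hf => rw [LinearMap.smul_apply, hf, smul_zero]
        refine (hg (u (R.erase i)) (mem_filter.2 ⟨mem_union_left _ (mem_image_of_mem _
          (mem_powerset.2 hR')), hu0 _ hc'⟩)).1 ?_
        rw [← hxi]
        exact hkill _ hmem
      · exact hon R (fun t ht => (mem_insert.1 (hR ht)).resolve_left
          fun (e : t = i) => hiR (e ▸ ht)) hc
    · have htY : ∀ t ∈ tight x'' (insert i Y) w, t ≠ i → t ∈ tight x' Y w := by
        intro t ht hti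
        obtain ⟨a, b⟩ := mem_tight.1 ht
        have a' := (mem_insert.1 a).resolve_left hti
        rw [hxt t a'] at b
        exact mem_tight.2 ⟨a', b⟩
      by_cases hiw : i ∈ tight x'' (insert i Y) w
      · have hcard : #(tight x'' (insert i Y) w) ≤ #(tight x' Y w) + 1 := by
          rw [← card_erase_add_one hiw]
          refine Nat.add_le_add_right (card_le_card fun t ht => ?_) 1
          exact htY t (mem_of_mem_erase ht) (ne_of_mem_erase ht)
        rcases (h2 w hw).lt_or_eq with hlt | heq
        · omega
        · -- `w` is one of the finitely many vertices that were avoided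
          exfalso
          let p : Finset ι × Finset ι :=
            (Y.filter fun t => x' t w = 0, Y.filter fun t => x' t w = 1)
          have hQw : Q p w := ⟨hw, fun t ht => (mem_filter.1 ht).2, fun t ht => (mem_filter.1 ht).2⟩
          have hQz := hz p ⟨w, hQw⟩
          have hwz : w - z p = 0 := by
            refine eq_zero_of_linearIndepOn (h1 (tight x' Y w)
              (fun t ht => (mem_tight.1 ht).1) heq.le) heq fun t ht => ?_
            obtain ⟨a, b | b⟩ := mem_tight.1 ht
            · rw [map_sub, b, hQz.2.1 t (mem_filter.2 ⟨a, b⟩), sub_zero]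
            · rw [map_sub, b, hQz.2.2 t (mem_filter.2 ⟨a, b⟩), sub_self]
          have hwE : w ∈ E := by
            refine mem_filter.2
              ⟨mem_union_right _ (mem_image.2 ⟨p, ?_, (sub_eq_zero.1 hwz).symm⟩), hw⟩
            exact mem_product.2 ⟨mem_powerset.2 (filter_subset _ _),
              mem_powerset.2 (filter_subset _ _)⟩
          have := hg w hwE
          rw [← hxi] at this
          have h4 := (mem_tight.1 hiw).2
          tauto
      · exact (card_le_card fun t ht => htY t ht fun e => hiw (e ▸ ht)).trans (h2 w hw)
    · by_cases hj : j = i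
      · rw [hj, hxi]
        exact hg' θ hθ
      · have : x'' j = x' j := Function.update_of_ne hj _ _
        rw [this]
        exact h3 j θ hθ

end Perturbation

/-! ### The shallow shatter function of slabs -/

section Traces

/-- A slab can be widened so that no point lies on its boundary, and then rescaled to width one. The
parameters `θ` are its normal vector and its lower offset. -/
lemma exists_unit_slab {d n : ℕ} {p : Fin n → EuclideanSpace ℝ (Fin d)}
    {S : Set (EuclideanSpace ℝ (Fin d))} (hS : IsSlab S) (v : Finset (Fin n))
    (hv : ∀ i, i ∈ v ↔ p i ∈ S) :
    ∃ θ : EuclideanSpace ℝ (Fin d) × ℝ, ∀ i,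
      (i ∈ v → 0 < inner ℝ θ.1 (p i) - θ.2 ∧ inner ℝ θ.1 (p i) - θ.2 < 1) ∧
      (i ∉ v → inner ℝ θ.1 (p i) - θ.2 < 0 ∨ 1 < inner ℝ θ.1 (p i) - θ.2) := by
  obtain ⟨w, a, b, -, hab, rfl⟩ := hS
  have hgap : ∀ᶠ g : ℝ in nhdsWithin 0 (Set.Ioi 0), 0 < g ∧ ∀ i : Fin n, i ∉ v →
      inner ℝ w (p i) < a - g ∨ b + g < inner ℝ w (p i) := by
    refine eventually_mem_nhdsWithin.and (Filter.eventually_all.2 fun i => ?_)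
    by_cases hi : i ∈ v
    · exact Filter.Eventually.of_forall fun _ h => absurd hi h
    · have hout : inner ℝ w (p i) < a ∨ b < inner ℝ w (p i) := by
        by_contra! hh
        exact hi ((hv i).2 ⟨hh.1, hh.2⟩)
      have hlt : ∀ c : ℝ, 0 < c → ∀ᶠ g : ℝ in nhdsWithin 0 (Set.Ioi 0), g < c := fun c hc =>
        eventually_nhdsWithin_of_eventually_nhds (eventually_lt_nhds hc)
      rcases hout with h | h
      · exact (hlt (a - inner ℝ w (p i)) (by linarith)).mono fun g hg _ => Or.inl (by linarith)
      · exact (hlt (inner ℝ w (p i) - b) (by linarith)).mono fun g hg _ => Or.inr (by linarith)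
  obtain ⟨g, hg, hgi⟩ := hgap.exists
  have hc : 0 < b - a + 2 * g := by linarith
  refine ⟨((b - a + 2 * g)⁻¹ • w, (a - g) / (b - a + 2 * g)), fun i => ?_⟩
  have hval : inner ℝ ((b - a + 2 * g)⁻¹ • w) (p i) - (a - g) / (b - a + 2 * g) =
      (inner ℝ w (p i) - (a - g)) / (b - a + 2 * g) := by
    rw [real_inner_smul_left]
    ring
  simp only [hval]
  rw [div_lt_one hc, one_lt_div hc]
  constructor
  · intro hi
    obtain ⟨h1, h2⟩ := (hv i).1 hi
    exact ⟨div_pos (by linarith) hc, by linarith⟩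
  · intro hi
    rcases hgi i hi with h | h
    · exact Or.inl (div_neg_of_neg_of_pos (by linarith) hc)
    · exact Or.inr (by linarith)

/-- The sets that slabs cut out of `p`, as the sets of pairs of walls between which a point lies,
for functionals in general position. -/
lemma exists_genPos_representation {d n : ℕ} {p : Fin n → EuclideanSpace ℝ (Fin d)}
    {V : Finset (Finset (Fin n))} (hV : IsSlabSystem p V) :
    ∃ (x : Fin n → Dual ℝ (EuclideanSpace ℝ (Fin d) × ℝ))
      (θ : Finset (Fin n) → EuclideanSpace ℝ (Fin d) × ℝ), GenPos x univ ∧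
      ∀ v ∈ V, ∀ Y, mids x Y (θ v) = v ∩ Y := by
  classical
  have hex : ∀ v ∈ V, ∃ θ : EuclideanSpace ℝ (Fin d) × ℝ, ∀ i,
      (i ∈ v → 0 < inner ℝ θ.1 (p i) - θ.2 ∧ inner ℝ θ.1 (p i) - θ.2 < 1) ∧
      (i ∉ v → inner ℝ θ.1 (p i) - θ.2 < 0 ∨ 1 < inner ℝ θ.1 (p i) - θ.2) := fun v hv => by
    obtain ⟨S, hS, h⟩ := hV v hv
    exact exists_unit_slab hS v h
  choose! θ hθ using hex
  let x : Fin n → Dual ℝ (EuclideanSpace ℝ (Fin d) × ℝ) := fun i =>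
    (innerₗ (EuclideanSpace ℝ (Fin d)) (p i)).comp (LinearMap.fst ℝ _ _) - LinearMap.snd ℝ _ _
  have hx : ∀ i t, x i t = inner ℝ t.1 (p i) - t.2 := fun i t => by
    simp [x, real_inner_comm]
  simp only [← hx] at hθ
  have hmargin : ∀ᶠ η : ℝ in nhdsWithin 0 (Set.Ioi 0), 0 < η ∧ ∀ v ∈ V, ∀ i,
      (i ∈ v → η < x i (θ v) ∧ η < 1 - x i (θ v)) ∧
      (i ∉ v → η < -x i (θ v) ∨ η < x i (θ v) - 1) := by
    have hlt : ∀ c : ℝ, 0 < c → ∀ᶠ g : ℝ in nhdsWithin 0 (Set.Ioi 0), g < c := fun c hc =>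
      eventually_nhdsWithin_of_eventually_nhds (eventually_lt_nhds hc)
    refine eventually_mem_nhdsWithin.and ((Finset.eventually_all V).2 fun v hv =>
      Filter.eventually_all.2 fun i => ?_)
    obtain ⟨h1, h2⟩ := hθ v hv i
    by_cases hi : i ∈ v
    · obtain ⟨a, b⟩ := h1 hi
      filter_upwards [hlt _ a, hlt _ (sub_pos.2 b)] with η e1 e2
      exact ⟨fun _ => ⟨e1, e2⟩, fun h => absurd hi h⟩
    · rcases h2 hi with a | a
      · filter_upwards [hlt _ (neg_pos.2 a)] with η e1
        exact ⟨fun h => absurd h hi, fun _ => Or.inl e1⟩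
      · filter_upwards [hlt _ (sub_pos.2 a)] with η e1
        exact ⟨fun h => absurd h hi, fun _ => Or.inr e1⟩
  obtain ⟨η, hη, hm⟩ := hmargin.exists
  obtain ⟨x', hgp, hnear⟩ := exists_genPos_near x (V.image θ) univ hη
  refine ⟨x', θ, hgp, fun v hv Y => ?_⟩
  ext i
  rw [mem_mids, mem_inter]
  have hd := abs_lt.1 (hnear i (θ v) (mem_image_of_mem _ hv))
  obtain ⟨h1, h2⟩ := hm v hv i
  constructor
  · rintro ⟨hiY, a, b⟩
    refine ⟨by_contra fun hi => ?_, hiY⟩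
    rcases h2 hi with h | h <;> linarith
  · rintro ⟨hi, hiY⟩
    obtain ⟨a, b⟩ := h1 hi
    exact ⟨hiY, by linarith, by linarith⟩

/-- The shallow shatter function of slabs: at most `O(m ^ d * r)` sets of size at most `r` are cut
out of `m` points. -/
theorem exists_card_traces_le {d : ℕ} (hd : 1 ≤ d) : ∃ K : ℝ, 0 ≤ K ∧ ∀ (n : ℕ)
    (p : Fin n → EuclideanSpace ℝ (Fin d)) (V : Finset (Finset (Fin n))), IsSlabSystem p V →
    ∀ (Y : Finset (Fin n)) (r : ℕ),
      (#((V.image (· ∩ Y)).filter fun u => #u ≤ r) : ℝ) ≤ K * ((r + 1) * (#Y + 1) ^ d) := by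
  classical
  obtain ⟨m, rfl⟩ := Nat.exists_eq_add_of_le' hd
  obtain ⟨K, hK0, hK⟩ := exists_card_cells_le m
  refine ⟨K, hK0, fun n p V hV Y r => ?_⟩
  obtain ⟨x, θ, hgp, hmids⟩ := exists_genPos_representation hV
  have hfin : finrank ℝ (EuclideanSpace ℝ (Fin (m + 1)) × ℝ) = m + 2 := by
    simp
  refine le_trans ?_ (hK _ _ x Y r hfin (hgp.subset (subset_univ _)))
  have hex : ∀ u ∈ (V.image (· ∩ Y)).filter (fun u => #u ≤ r), ∃ v ∈ V, v ∩ Y = u := fun u hu =>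
    mem_image.1 (mem_filter.1 hu).1
  choose! v hvV hv using hex
  have : #((V.image (· ∩ Y)).filter fun u => #u ≤ r) ≤
      #(cells x Y fun w => #(mids x Y w) ≤ r) := by
    refine card_le_card_of_injOn (fun u => cell x Y (θ (v u))) (fun u hu => ?_)
      fun u hu u' hu' he => ?_
    · refine mem_cells.2 ⟨_, ?_, rfl⟩
      rw [hmids _ (hvV u hu), hv u hu]
      exact (mem_filter.1 hu).2
    · have := mids_congr he
      rwa [hmids _ (hvV u hu), hv u hu, hmids _ (hvV u' hu'), hv u' hu'] at this
  exact_mod_cast this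

end Traces

/-! ### Unit distance graphs -/

section UnitDistance
variable {α : Type*} [DecidableEq α]

/-- Haussler's bound on the density of the unit distance graph of a set family. -/
lemma sum_card_unit_edges_le (Y : Finset α) : ∀ (F : Finset (Finset α)) (d : ℕ),
    (∀ u ∈ F, u ⊆ Y) → (∀ T, F.Shatters T → #T ≤ d) →
    ∑ a ∈ Y, #{u ∈ F | a ∉ u ∧ insert a u ∈ F} ≤ d * #F := by
  induction Y using Finset.induction_on with
  | empty => intro F d _ _; simp
  | insert b Y hb ih =>
    intro F d hF hd
    set F₀ := F.nonMemberSubfamily b with hF₀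
    set F₁ := F.memberSubfamily b with hF₁
    have h0 : ∀ u ∈ F₀, u ⊆ Y := fun u hu t ht => by
      obtain ⟨h1, h2⟩ := mem_nonMemberSubfamily.1 hu
      exact (mem_insert.1 (hF u h1 ht)).resolve_left fun e => h2 (e ▸ ht)
    have h1 : ∀ u ∈ F₁, u ⊆ Y := fun u hu t ht => by
      obtain ⟨h1, h2⟩ := mem_memberSubfamily.1 hu
      exact (mem_insert.1 (hF _ h1 (mem_insert_of_mem ht))).resolve_left fun e => h2 (e ▸ ht)
    have hun : ∑ a ∈ Y, #{u ∈ F₀ ∪ F₁ | a ∉ u ∧ insert a u ∈ F₀ ∪ F₁} ≤ d * #(F₀ ∪ F₁) := by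
      refine ih _ d (fun u hu => (mem_union.1 hu).elim (h0 u) (h1 u)) fun T hT => hd T ?_
      have hbT : b ∉ T := by
        obtain ⟨u, hu, he⟩ := hT (Subset.refl T)
        intro hbT
        rw [← he] at hbT
        have := (mem_union.1 hu).elim (h0 u) (h1 u) (mem_inter.1 hbT).2
        exact hb this
      intro t ht
      obtain ⟨u, hu, he⟩ := hT ht
      rcases mem_union.1 hu with hu | hu
      · exact ⟨u, (mem_nonMemberSubfamily.1 hu).1, he⟩
      · refine ⟨insert b u, (mem_memberSubfamily.1 hu).1, ?_⟩
        rw [inter_insert_of_notMem hbT, he]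
    have hin : ∑ a ∈ Y, #{u ∈ F₀ ∩ F₁ | a ∉ u ∧ insert a u ∈ F₀ ∩ F₁} + #(F₀ ∩ F₁) ≤
        d * #(F₀ ∩ F₁) := by
      rcases (F₀ ∩ F₁).eq_empty_or_nonempty with he | ⟨u₀, hu₀⟩
      · rw [he]
        simp
      · have hsh : ∀ T, (F₀ ∩ F₁).Shatters T → #T + 1 ≤ d := by
          intro T hT
          have hbT : b ∉ T := by
            obtain ⟨u, hu, he⟩ := hT (Subset.refl T)
            intro hbT
            rw [← he] at hbT
            exact hb (h0 u (mem_inter.1 hu).1 (mem_inter.1 hbT).2)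
          rw [← card_insert_of_notMem hbT]
          refine hd _ fun t ht => ?_
          obtain ⟨u, hu, he⟩ := hT (t := t.erase b) (fun s hs => by
            obtain ⟨h1, h2⟩ := mem_erase.1 hs
            exact (mem_insert.1 (ht h2)).resolve_left h1)
          obtain ⟨hu0, hu1⟩ := mem_inter.1 hu
          have hbu : b ∉ u := (mem_nonMemberSubfamily.1 hu0).2
          by_cases hbt : b ∈ t
          · refine ⟨insert b u, (mem_memberSubfamily.1 hu1).1, ?_⟩
            rw [← insert_inter_distrib, he, insert_erase hbt]
          · refine ⟨u, (mem_nonMemberSubfamily.1 hu0).1, ?_⟩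
            rw [insert_inter_of_notMem hbu, he, erase_eq_of_notMem hbt]
        have hd1 : 1 ≤ d := by
          have := hsh ∅ (fun t ht => ⟨u₀, hu₀, by rw [subset_empty.1 ht, empty_inter]⟩)
          simpa using this
        have := ih (F₀ ∩ F₁) (d - 1) (fun u hu => h0 u (mem_inter.1 hu).1) fun T hT => by
          have := hsh T hT
          omega
        calc _ ≤ (d - 1) * #(F₀ ∩ F₁) + 1 * #(F₀ ∩ F₁) := by omega
          _ = _ := by rw [← add_mul, Nat.sub_add_cancel hd1]
    have hb' : #{u ∈ F | b ∉ u ∧ insert b u ∈ F} = #(F₀ ∩ F₁) := by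
      congr 1
      ext u
      simp only [hF₀, hF₁, mem_filter, mem_inter, mem_nonMemberSubfamily, mem_memberSubfamily]
      tauto
    have ha : ∀ a ∈ Y, #{u ∈ F | a ∉ u ∧ insert a u ∈ F} ≤
        #{u ∈ F₀ ∪ F₁ | a ∉ u ∧ insert a u ∈ F₀ ∪ F₁} +
        #{u ∈ F₀ ∩ F₁ | a ∉ u ∧ insert a u ∈ F₀ ∩ F₁} := by
      intro a haY
      have hab : a ≠ b := fun e => hb (e ▸ haY)
      set A := F₀.filter (fun u => a ∉ u ∧ insert a u ∈ F₀) with hA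
      set B := F₁.filter (fun u => a ∉ u ∧ insert a u ∈ F₁) with hB
      have hsplit : #{u ∈ F | a ∉ u ∧ insert a u ∈ F} ≤ #A + #B := by
        rw [← card_filter_add_card_filter_not (fun u => b ∉ u)]
        refine add_le_add (card_le_card fun u hu => ?_)
          (card_le_card_of_injOn (fun u => u.erase b) (fun u hu => ?_) fun u hu u' hu' he => ?_)
        · obtain ⟨hu, hbu⟩ := mem_filter.1 hu
          obtain ⟨hu, hau, hin⟩ := mem_filter.1 hu
          refine mem_filter.2 ⟨mem_nonMemberSubfamily.2 ⟨hu, hbu⟩, hau,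
            mem_nonMemberSubfamily.2 ⟨hin, ?_⟩⟩
          simp [hbu, hab.symm]
        · obtain ⟨hu, hbu⟩ := mem_filter.1 hu
          obtain ⟨hu, hau, hin⟩ := mem_filter.1 hu
          rw [not_not] at hbu
          refine mem_filter.2 ⟨mem_memberSubfamily.2 ⟨by rwa [insert_erase hbu], by simp⟩,
            fun hh => hau (mem_of_mem_erase hh), mem_memberSubfamily.2 ⟨?_, ?_⟩⟩
          · rw [Finset.insert_comm, insert_erase hbu]
            exact hin
          · simp [hab.symm]
        · have hbu := (mem_filter.1 hu).2
          have hbu' := (mem_filter.1 hu').2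
          rw [not_not] at hbu hbu'
          have he : u.erase b = u'.erase b := he
          rw [← insert_erase hbu, he, insert_erase hbu']
      refine hsplit.trans ?_
      rw [← card_union_add_card_inter]
      refine add_le_add (card_le_card fun u hu => ?_) (card_le_card fun u hu => ?_)
      · rcases mem_union.1 hu with hu | hu <;> obtain ⟨e1, e2, e3⟩ := mem_filter.1 hu
        · exact mem_filter.2 ⟨mem_union_left _ e1, e2, mem_union_left _ e3⟩
        · exact mem_filter.2 ⟨mem_union_right _ e1, e2, mem_union_right _ e3⟩
      · obtain ⟨hu1, hu2⟩ := mem_inter.1 hu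
        obtain ⟨e1, e2, e3⟩ := mem_filter.1 hu1
        obtain ⟨e1', -, e3'⟩ := mem_filter.1 hu2
        exact mem_filter.2 ⟨mem_inter.2 ⟨e1, e1'⟩, e2, mem_inter.2 ⟨e3, e3'⟩⟩
    rw [sum_insert hb, hb']
    calc _ ≤ #(F₀ ∩ F₁) + (∑ a ∈ Y, #{u ∈ F₀ ∪ F₁ | a ∉ u ∧ insert a u ∈ F₀ ∪ F₁} +
          ∑ a ∈ Y, #{u ∈ F₀ ∩ F₁ | a ∉ u ∧ insert a u ∈ F₀ ∩ F₁}) := by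
          rw [← sum_add_distrib]
          exact Nat.add_le_add_left (sum_le_sum ha) _
      _ ≤ d * #(F₀ ∪ F₁) + d * #(F₀ ∩ F₁) := by omega
      _ = d * (#F₁ + #F₀) := by
          rw [← mul_add, card_union_add_card_inter, add_comm (#F₀)]
      _ = _ := by rw [card_memberSubfamily_add_card_nonMemberSubfamily]

/-- The weighted version: every edge has the smaller of the weights of its ends. It follows from the
unweighted one for the families of the sets of weight greater than `t`, by summing over `t`. -/
lemma sum_min_weight_le (Y : Finset α) (m : Finset α → ℕ) (d : ℕ)
    (hd : ∀ T, (Y.powerset.filter fun u => 0 < m u).Shatters T → #T ≤ d) :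
    ∑ a ∈ Y, ∑ u ∈ (Y.erase a).powerset, min (m u) (m (insert a u)) ≤
      d * ∑ u ∈ Y.powerset, m u := by
  obtain ⟨N, hN⟩ : ∃ N, ∀ u ∈ Y.powerset, m u ≤ N := ⟨∑ u ∈ Y.powerset, m u, fun u hu =>
    single_le_sum (f := m) (fun _ _ => Nat.zero_le _) hu⟩
  let F : ℕ → Finset (Finset α) := fun t => Y.powerset.filter fun u => t < m u
  have hlayer : ∀ c ≤ N, c = ∑ t ∈ range N, if t < c then 1 else 0 := by
    intro c hc
    rw [← card_filter]
    have : (range N).filter (fun t => t < c) = range c := by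
      ext t
      simp only [mem_filter, mem_range]
      omega
    rw [this, card_range]
  have hF : ∑ u ∈ Y.powerset, m u = ∑ t ∈ range N, #(F t) := by
    rw [sum_congr rfl fun u hu => hlayer (m u) (hN u hu), sum_comm]
    exact sum_congr rfl fun t _ => (card_filter _ _).symm
  have hE : ∀ a ∈ Y, ∑ u ∈ (Y.erase a).powerset, min (m u) (m (insert a u)) =
      ∑ t ∈ range N, #{u ∈ F t | a ∉ u ∧ insert a u ∈ F t} := by
    intro a ha
    have hcard : ∀ t, #{u ∈ F t | a ∉ u ∧ insert a u ∈ F t} =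
        ∑ u ∈ (Y.erase a).powerset, if t < min (m u) (m (insert a u)) then 1 else 0 := by
      intro t
      rw [← card_filter]
      congr 1
      ext u
      simp only [F, mem_filter, mem_powerset, lt_min_iff]
      constructor
      · rintro ⟨⟨h1, h2⟩, h3, h4, h5⟩
        exact ⟨fun s hs => mem_erase.2 ⟨fun e => h3 (e ▸ hs), h1 hs⟩, h2, h5⟩
      · rintro ⟨h1, h2, h3⟩
        exact ⟨⟨h1.trans (erase_subset _ _), h2⟩, fun h => by simpa using h1 h,
          insert_subset ha (h1.trans (erase_subset _ _)), h3⟩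
    simp_rw [hcard]
    rw [sum_comm]
    refine sum_congr rfl fun u hu => hlayer _ ((min_le_left _ _).trans (hN u ?_))
    exact mem_powerset.2 ((mem_powerset.1 hu).trans (erase_subset _ _))
  rw [sum_congr rfl hE, sum_comm, hF, mul_sum]
  refine sum_le_sum fun t _ => sum_card_unit_edges_le Y (F t) d
    (fun u hu => mem_powerset.1 (mem_filter.1 hu).1) fun T hT => hd T fun s hs => ?_
  obtain ⟨u, hu, he⟩ := hT hs
  obtain ⟨h1, h2⟩ := mem_filter.1 hu
  exact ⟨u, mem_filter.2 ⟨h1, by omega⟩, he⟩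

end UnitDistance

/-! ### Separated families -/

section Packing
variable {α : Type} [DecidableEq α]

/-- The weight of the unit edges in direction `a` in the trace of `V` on `Y`, where each trace is
weighted by the number of members of `V` that have it. -/
def edgeWeight (V : Finset (Finset α)) (Y : Finset α) (a : α) : ℕ :=
  ∑ u ∈ (Y.erase a).powerset, min #{v ∈ V | v ∩ Y = u} #{v ∈ V | v ∩ Y = insert a u}

lemma sum_edgeWeight_le (V : Finset (Finset α)) (Y : Finset α) {d : ℕ}
    (hd : ∀ T, V.Shatters T → #T ≤ d) : ∑ a ∈ Y, edgeWeight V Y a ≤ d * #V := by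
  refine (sum_min_weight_le Y (fun u => #{v ∈ V | v ∩ Y = u}) d fun T hT => hd T ?_).trans ?_
  · -- a set shattered by the traces lies in `Y`, and is shattered by the family
    intro t ht
    have hTY : T ⊆ Y := by
      obtain ⟨u, hu, he⟩ := hT (Subset.refl T)
      have := mem_powerset.1 (mem_filter.1 hu).1
      exact (inter_eq_left.1 he).trans this
    obtain ⟨u, hu, he⟩ := hT ht
    obtain ⟨v, hv⟩ := card_pos.1 (mem_filter.1 hu).2
    obtain ⟨hv, hvu⟩ := mem_filter.1 hv
    refine ⟨v, hv, ?_⟩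
    rw [← he, ← hvu, inter_comm v Y, ← inter_assoc, inter_eq_left.2 hTY]
  · refine Nat.mul_le_mul_left _ (le_of_eq ?_)
    exact (card_eq_sum_card_fiberwise fun v _ => mem_powerset.2 inter_subset_right).symm

/-- In a class of sets with the same trace on `Y`, an element of `X \ Y` separates on average
more than a `δ / #X` fraction of the pairs, since any two sets differ in more than `δ` places. -/
lemma sum_edgeWeight_insert_ge {X Y : Finset α} {V : Finset (Finset α)} {δ : ℕ}
    (hV : ∀ v ∈ V, v ⊆ X) (hδ : ∀ v ∈ V, ∀ v' ∈ V, v ≠ v' → δ < #(symmDiff v v')) :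
    (#V - #(V.image (· ∩ Y))) * δ ≤ 2 * ∑ a ∈ X \ Y, edgeWeight V (insert a Y) a := by
  set C : Finset α → Finset (Finset α) := fun u => V.filter fun v => v ∩ Y = u with hC
  have hclass : ∀ u ∈ V.image (· ∩ Y), (#(C u) - 1) * δ ≤
      2 * ∑ a ∈ X \ Y, min #{v ∈ C u | a ∉ v} #{v ∈ C u | a ∈ v} := by
    intro u hu
    obtain ⟨v₀, hv₀, rfl⟩ := mem_image.1 hu
    set D := C (v₀ ∩ Y)
    have hDV : ∀ v ∈ D, v ∈ V ∧ v ∩ Y = v₀ ∩ Y := fun v hv => mem_filter.1 hv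
    have hpos : 0 < #D := card_pos.2 ⟨v₀, mem_filter.2 ⟨hv₀, rfl⟩⟩
    -- the ordered pairs of the class, counted with their differences
    set P := ∑ v ∈ D, ∑ v' ∈ D, #(v \ v') with hP
    have hlow : #D * ((#D - 1) * δ) ≤ 2 * P := by
      have e : 2 * P = ∑ v ∈ D, ∑ v' ∈ D, #(symmDiff v v') := by
        have hs : P = ∑ v ∈ D, ∑ v' ∈ D, #(v' \ v) := by rw [hP, sum_comm]
        rw [two_mul]
        nth_rewrite 2 [hs]
        rw [hP, ← sum_add_distrib]
        refine sum_congr rfl fun v _ => ?_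
        rw [← sum_add_distrib]
        refine sum_congr rfl fun v' _ => ?_
        rw [symmDiff_def, sup_eq_union, card_union_of_disjoint]
        exact disjoint_left.2 fun i h1 h2 => (mem_sdiff.1 h2).2 (mem_sdiff.1 h1).1
      rw [e, ← smul_eq_mul]
      refine card_nsmul_le_sum _ _ _ fun v hv => ?_
      rw [← card_erase_of_mem hv, ← smul_eq_mul]
      refine (card_nsmul_le_sum (D.erase v) (fun v' => #(symmDiff v v')) δ fun v' hv' => ?_).trans
        (sum_le_sum_of_subset (erase_subset _ _))
      obtain ⟨h1, h2⟩ := mem_erase.1 hv'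
      exact (hδ v (hDV v hv).1 v' (hDV v' h2).1 h1.symm).le
    have hup : P ≤ #D * ∑ a ∈ X \ Y, min #{v ∈ D | a ∉ v} #{v ∈ D | a ∈ v} := by
      have e : P = ∑ a ∈ X \ Y, #{v ∈ D | a ∈ v} * #{v ∈ D | a ∉ v} := by
        have h1 : ∀ v ∈ D, ∀ v' ∈ D, #(v \ v') =
            ∑ a ∈ X \ Y, (if a ∈ v then 1 else 0) * (if a ∉ v' then 1 else 0) := by
          intro v hv v' hv'
          have : v \ v' = (X \ Y).filter fun a => a ∈ v ∧ a ∉ v' := by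
            ext a
            simp only [mem_sdiff, mem_filter]
            constructor
            · rintro ⟨ha, ha'⟩
              refine ⟨⟨hV v (hDV v hv).1 ha, fun haY => ha' ?_⟩, ha, ha'⟩
              have : a ∈ v ∩ Y := mem_inter.2 ⟨ha, haY⟩
              rw [(hDV v hv).2, ← (hDV v' hv').2] at this
              exact (mem_inter.1 this).1
            · exact fun h => h.2
          rw [this, card_filter]
          refine sum_congr rfl fun a _ => ?_
          by_cases ha : a ∈ v <;> by_cases ha' : a ∈ v' <;> simp [ha, ha']
        rw [hP, sum_congr rfl fun v hv => sum_congr rfl fun v' hv' => h1 v hv v' hv']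
        simp_rw [card_filter, sum_mul_sum]
        exact (sum_congr rfl fun v _ => sum_comm).trans sum_comm
      rw [e, mul_sum]
      refine sum_le_sum fun a _ => ?_
      have l1 : #{v ∈ D | a ∈ v} ≤ #D := card_filter_le _ _
      have l2 : #{v ∈ D | a ∉ v} ≤ #D := card_filter_le _ _
      rcases le_total #{v ∈ D | a ∉ v} #{v ∈ D | a ∈ v} with h | h
      · rw [min_eq_left h]
        exact Nat.mul_le_mul_right _ l1
      · rw [min_eq_right h, mul_comm]
        exact Nat.mul_le_mul_right _ l2
    refine Nat.le_of_mul_le_mul_left ?_ hpos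
    calc _ ≤ 2 * P := hlow
      _ ≤ 2 * _ := Nat.mul_le_mul_left _ hup
      _ = _ := by ring
  have hw : ∀ a ∈ X \ Y, ∑ u ∈ V.image (· ∩ Y), min #{v ∈ C u | a ∉ v} #{v ∈ C u | a ∈ v} ≤
      edgeWeight V (insert a Y) a := by
    intro a ha
    have haY : a ∉ Y := (mem_sdiff.1 ha).2
    rw [edgeWeight, erase_insert haY]
    refine (sum_le_sum fun u hu => ?_).trans (sum_le_sum_of_subset
      (s := V.image (· ∩ Y)) fun u hu => ?_)
    · have huY : a ∉ u := by
        obtain ⟨v, -, rfl⟩ := mem_image.1 hu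
        exact fun h => haY (mem_inter.1 h).2
      refine le_of_eq (congrArg₂ min ?_ ?_)
      · congr 1
        ext v
        simp only [hC, mem_filter, and_assoc]
        refine and_congr_right fun _ => ?_
        constructor
        · rintro ⟨h1, h2⟩
          rw [inter_insert_of_notMem h2, h1]
        · intro h
          have hav : a ∉ v := fun hav => huY (by
            rw [← h]
            exact mem_inter.2 ⟨hav, mem_insert_self _ _⟩)
          rw [inter_insert_of_notMem hav] at h
          exact ⟨h, hav⟩
      · congr 1
        ext v
        simp only [hC, mem_filter, and_assoc]
        refine and_congr_right fun _ => ?_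
        constructor
        · rintro ⟨h1, h2⟩
          rw [inter_insert_of_mem h2, h1]
        · intro h
          have hav : a ∈ v := by
            have : a ∈ v ∩ insert a Y := by
              rw [h]
              exact mem_insert_self _ _
            exact (mem_inter.1 this).1
          rw [inter_insert_of_mem hav] at h
          refine ⟨?_, hav⟩
          have := congrArg (fun s => s.erase a) h
          simpa [erase_insert, huY, haY] using this
    · obtain ⟨v, -, rfl⟩ := mem_image.1 hu
      exact mem_powerset.2 inter_subset_right
  calc (#V - #(V.image (· ∩ Y))) * δ = (∑ u ∈ V.image (· ∩ Y), (#(C u) - 1)) * δ := by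
        congr 1
        have h1 : #V = ∑ u ∈ V.image (· ∩ Y), #(C u) :=
          card_eq_sum_card_fiberwise fun v hv => mem_image_of_mem _ hv
        have h2 : ∀ u ∈ V.image (· ∩ Y), 1 ≤ #(C u) := fun u hu => by
          obtain ⟨v, hv, e⟩ := mem_image.1 hu
          exact card_pos.2 ⟨v, mem_filter.2 ⟨hv, e⟩⟩
        rw [sum_tsub_distrib _ h2, ← h1]
        simp
    _ = ∑ u ∈ V.image (· ∩ Y), (#(C u) - 1) * δ := sum_mul _ _ _
    _ ≤ ∑ u ∈ V.image (· ∩ Y), 2 * ∑ a ∈ X \ Y, min #{v ∈ C u | a ∉ v} #{v ∈ C u | a ∈ v} :=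
        sum_le_sum hclass
    _ = 2 * ∑ a ∈ X \ Y, ∑ u ∈ V.image (· ∩ Y), min #{v ∈ C u | a ∉ v} #{v ∈ C u | a ∈ v} := by
        rw [← mul_sum, sum_comm]
    _ ≤ _ := Nat.mul_le_mul_left _ (sum_le_sum hw)

/-- Exchanging the roles of a sample with a distinguished element and a sample without it. -/
lemma mul_sampleMean_insert_le {p : ℝ} (h0 : 0 ≤ p) (h1 : p ≤ 1) (X : Finset α)
    (f : Finset α → α → ℝ) (hf : ∀ Y a, 0 ≤ f Y a) :
    p * sampleMean p X (fun Y => ∑ a ∈ X \ Y, f (insert a Y) a) ≤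
      sampleMean p X (fun Y => ∑ a ∈ Y, f Y a) := by
  have hq : 0 ≤ 1 - p := sub_nonneg.2 h1
  have hL : p * sampleMean p X (fun Y => ∑ a ∈ X \ Y, f (insert a Y) a) =
      ∑ z ∈ X.powerset.sigma fun Y => X \ Y,
        p * (p ^ #z.1 * (1 - p) ^ #(X \ z.1) * f (insert z.2 z.1) z.2) := by
    rw [sampleMean, mul_sum, sum_sigma]
    exact sum_congr rfl fun Y _ => by rw [mul_sum, mul_sum]
  have hR : sampleMean p X (fun Y => ∑ a ∈ Y, f Y a) =
      ∑ z ∈ X.powerset.sigma fun Y => Y,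
        p ^ #z.1 * (1 - p) ^ #(X \ z.1) * f z.1 z.2 := by
    rw [sampleMean, sum_sigma]
    exact sum_congr rfl fun Y _ => by rw [mul_sum]
  have hbij : ∑ z ∈ X.powerset.sigma fun Y => X \ Y,
        p ^ #(insert z.2 z.1) * (1 - p) ^ #(X \ insert z.2 z.1) * f (insert z.2 z.1) z.2 =
      ∑ z ∈ X.powerset.sigma fun Y => Y,
        p ^ #z.1 * (1 - p) ^ #(X \ z.1) * f z.1 z.2 := by
    refine sum_bij' (fun z _ => ⟨insert z.2 z.1, z.2⟩) (fun z _ => ⟨z.1.erase z.2, z.2⟩)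
      ?_ ?_ ?_ ?_ ?_
    · rintro ⟨Y, a⟩ h
      simp only [mem_sigma, mem_powerset, mem_sdiff] at h ⊢
      exact ⟨insert_subset h.2.1 h.1, mem_insert_self _ _⟩
    · rintro ⟨Y, a⟩ h
      simp only [mem_sigma, mem_powerset, mem_sdiff] at h ⊢
      exact ⟨(erase_subset _ _).trans h.1, h.1 h.2, by simp⟩
    · rintro ⟨Y, a⟩ h
      simp only [mem_sigma, mem_powerset, mem_sdiff] at h
      simp [erase_insert h.2.2]
    · rintro ⟨Y, a⟩ h
      simp only [mem_sigma, mem_powerset] at h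
      simp [insert_erase h.2]
    · rintro ⟨Y, a⟩ h
      rfl
  rw [hL, hR, ← hbij]
  refine sum_le_sum ?_
  rintro ⟨Y, a⟩ h
  simp only [mem_sigma, mem_powerset, mem_sdiff] at h
  obtain ⟨hY, haX, haY⟩ := h
  have e1 : #(insert a Y) = #Y + 1 := card_insert_of_notMem haY
  have e2 : #(X \ Y) = #(X \ insert a Y) + 1 := by
    rw [sdiff_insert, card_erase_add_one (mem_sdiff.2 ⟨haX, haY⟩)]
  simp only [e1, e2, ← mul_assoc]
  refine mul_le_mul_of_nonneg_right ?_ (hf _ _)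
  calc p * p ^ #Y * (1 - p) ^ (#(X \ insert a Y) + 1)
      = p ^ (#Y + 1) * (1 - p) ^ #(X \ insert a Y) * (1 - p) := by ring
    _ ≤ p ^ (#Y + 1) * (1 - p) ^ #(X \ insert a Y) :=
      mul_le_of_le_one_right (by positivity) (by linarith)

/-- Haussler's packing argument: a sample of rate a large multiple of `d / δ` distinguishes most
members of a `δ`-separated family of VC dimension `d`. -/
lemma separated_sub_sampleMean_le {p : ℝ} (h0 : 0 ≤ p) (h1 : p ≤ 1) {X : Finset α}
    {V : Finset (Finset α)} {δ d : ℕ} (hV : ∀ v ∈ V, v ⊆ X)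
    (hδ : ∀ v ∈ V, ∀ v' ∈ V, v ≠ v' → δ < #(symmDiff v v'))
    (hd : ∀ T, V.Shatters T → #T ≤ d) :
    p * δ * (#V - sampleMean p X fun Y => (#(V.image (· ∩ Y)) : ℝ)) ≤ 2 * d * #V := by
  have hlow : δ * (#V - sampleMean p X fun Y => (#(V.image (· ∩ Y)) : ℝ)) ≤
      2 * sampleMean p X (fun Y => ∑ a ∈ X \ Y, (edgeWeight V (insert a Y) a : ℝ)) := by
    have e : δ * (#V - sampleMean p X fun Y => (#(V.image (· ∩ Y)) : ℝ)) =
        sampleMean p X fun Y => (δ : ℝ) * (#V + (-1) * (#(V.image (· ∩ Y)) : ℝ)) := by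
      rw [sampleMean_mul_left, sampleMean_add, sampleMean_const, sampleMean_mul_left]
      ring
    rw [e, ← sampleMean_mul_left]
    refine sampleMean_mono h0 h1 fun Y _ => ?_
    have h := sum_edgeWeight_insert_ge (Y := Y) hV hδ
    have hle : #(V.image (· ∩ Y)) ≤ #V := card_image_le
    have h' : ((#V - #(V.image (· ∩ Y)) : ℕ) : ℝ) * δ ≤
        2 * ∑ a ∈ X \ Y, (edgeWeight V (insert a Y) a : ℝ) := by exact_mod_cast h
    rw [Nat.cast_sub hle] at h'
    linarith
  have hup := mul_sampleMean_insert_le h0 h1 X (fun Y a => (edgeWeight V Y a : ℝ))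
    fun _ _ => Nat.cast_nonneg _
  have hmean : sampleMean p X (fun Y => ∑ a ∈ Y, (edgeWeight V Y a : ℝ)) ≤ d * #V := by
    rw [← sampleMean_const p X (d * #V : ℝ)]
    exact sampleMean_mono h0 h1 fun Y _ => by exact_mod_cast sum_edgeWeight_le V Y hd
  nlinarith [mul_le_mul_of_nonneg_left hlow h0]

/-- Markov's inequality for the size of the trace of a set of size at most `k`: few members of the
family have a trace of more than four times the expected size. -/
lemma sampleMean_card_traces_le {p : ℝ} (h0 : 0 < p) (h1 : p ≤ 1) {X : Finset α}
    {V : Finset (Finset α)} {k : ℕ} (hk : 1 ≤ k) (hV : ∀ v ∈ V, v ⊆ X) (hVk : ∀ v ∈ V, #v ≤ k) :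
    (sampleMean p X fun Y => (#(V.image (· ∩ Y)) : ℝ)) ≤
      (sampleMean p X fun Y => (#((V.image (· ∩ Y)).filter fun u => #u ≤ ⌊4 * p * k⌋₊) : ℝ)) +
        #V / 4 := by
  have hk' : (0 : ℝ) < k := by exact_mod_cast hk
  set s : ℝ := 4 * p * k with hs
  have hs0 : 0 < s := by positivity
  have hY : ∀ Y ⊆ X, (#(V.image (· ∩ Y)) : ℝ) ≤
      #((V.image (· ∩ Y)).filter fun u => #u ≤ ⌊s⌋₊) +
        (1 / s) * ∑ v ∈ V, ∑ i ∈ v, if {i} ⊆ Y then (1 : ℝ) else 0 := by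
    intro Y _
    have h1 : #(V.image (· ∩ Y)) ≤ #((V.image (· ∩ Y)).filter fun u => #u ≤ ⌊s⌋₊) +
        #(V.filter fun v => ¬ #(v ∩ Y) ≤ ⌊s⌋₊) := by
      rw [← card_filter_add_card_filter_not (s := V.image (· ∩ Y)) (fun u => #u ≤ ⌊s⌋₊)]
      refine Nat.add_le_add_left ?_ _
      rw [filter_image]
      exact card_image_le
    have h2 : (#(V.filter fun v => ¬ #(v ∩ Y) ≤ ⌊s⌋₊) : ℝ) ≤
        (1 / s) * ∑ v ∈ V, ∑ i ∈ v, if {i} ⊆ Y then (1 : ℝ) else 0 := by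
      have h3 : ∀ v, ∑ i ∈ v, (if {i} ⊆ Y then (1 : ℝ) else 0) = #(v ∩ Y) := by
        intro v
        simp only [singleton_subset_iff]
        rw [sum_boole, filter_mem_eq_inter]
      simp only [h3]
      rw [card_filter, mul_sum]
      push_cast
      refine sum_le_sum fun v _ => ?_
      split_ifs with h
      · positivity
      · rw [not_le, Nat.floor_lt hs0.le] at h
        rw [one_div, inv_mul_eq_div, one_le_div hs0]
        exact h.le
    have h1' : (#(V.image (· ∩ Y)) : ℝ) ≤
        #((V.image (· ∩ Y)).filter fun u => #u ≤ ⌊s⌋₊) +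
        #(V.filter fun v => ¬ #(v ∩ Y) ≤ ⌊s⌋₊) := by exact_mod_cast h1
    linarith
  refine (sampleMean_mono h0.le h1 hY).trans ?_
  rw [sampleMean_add, sampleMean_mul_left, sampleMean_sum]
  refine add_le_add_right ?_ _
  have h4 : ∑ v ∈ V, sampleMean p X (fun Y => ∑ i ∈ v, if {i} ⊆ Y then (1 : ℝ) else 0) ≤
      ∑ v ∈ V, (k * p : ℝ) := by
    refine sum_le_sum fun v hv => ?_
    rw [sampleMean_sum]
    have : ∀ i ∈ v, sampleMean p X (fun Y => if {i} ⊆ Y then (1 : ℝ) else 0) = p := fun i hi => by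
      rw [sampleMean_subset p (singleton_subset_iff.2 (hV v hv hi)), card_singleton, pow_one]
    rw [sum_congr rfl this, sum_const, nsmul_eq_mul]
    have : (#v : ℝ) ≤ k := by exact_mod_cast hVk v hv
    gcongr
  calc _ ≤ 1 / s * ∑ v ∈ V, (k * p : ℝ) := by gcongr
    _ = #V / 4 := by
      rw [sum_const, nsmul_eq_mul, hs]
      field_simp

end Packing

/-! ### Shallow packings of slabs -/

section SlabPacking

/-- The sets cut out by slabs have bounded VC dimension, as their shatter function is polynomial. -/
lemma exists_vcBound {d : ℕ} (hd : 1 ≤ d) : ∃ D : ℕ, ∀ (n : ℕ)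
    (p : Fin n → EuclideanSpace ℝ (Fin d)) (V : Finset (Finset (Fin n))), IsSlabSystem p V →
    ∀ T, V.Shatters T → #T ≤ D := by
  classical
  obtain ⟨K, hK0, hK⟩ := exists_card_traces_le hd
  have hlim := tendsto_pow_const_div_const_pow_of_one_lt (d + 1) (r := (2 : ℝ)) (by norm_num)
  have hev : ∀ᶠ m : ℕ in Filter.atTop, (m : ℝ) ^ (d + 1) / 2 ^ m < 1 / (2 * K + 1) :=
    hlim.eventually_lt_const (by positivity)
  obtain ⟨D, hD⟩ := Filter.eventually_atTop.1 hev
  refine ⟨D, fun n p V hV T hT => ?_⟩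
  by_contra! hlt
  have h1 := hK n p V hV T #T
  have h2 : T.powerset ⊆ (V.image (· ∩ T)).filter fun u => #u ≤ #T := by
    intro t ht
    have ht' := mem_powerset.1 ht
    obtain ⟨u, hu, he⟩ := hT ht'
    exact mem_filter.2 ⟨mem_image.2 ⟨u, hu, by rw [inter_comm]; exact he⟩, card_le_card ht'⟩
  have h3 : (2 : ℝ) ^ #T ≤ #((V.image (· ∩ T)).filter fun u => #u ≤ #T) := by
    have := card_le_card h2
    rw [card_powerset] at this
    exact_mod_cast this
  have h4 := hD (#T + 1) (by omega)
  rw [div_lt_div_iff₀ (by positivity) (by positivity)] at h4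
  push_cast at h4
  have h5 : ((#T : ℝ) + 1) * (#T + 1) ^ d = (#T + 1) ^ (d + 1) := by ring
  rw [h5] at h1
  have hpos : (0 : ℝ) < (#T + 1) ^ (d + 1) := by positivity
  have h6 : (2 : ℝ) ^ (#T + 1) = 2 * 2 ^ #T := by ring
  rw [h6] at h4
  nlinarith

/-- The shallow packing bound, for a single shallow separated family. -/
lemma exists_separated_card_le {d : ℕ} (hd : 1 ≤ d) : ∃ C : ℝ, 0 < C ∧ ∀ (n : ℕ)
    (p : Fin n → EuclideanSpace ℝ (Fin d)) (V : Finset (Finset (Fin n))), IsSlabSystem p V →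
    ∀ δ k : ℕ, 1 ≤ δ → δ ≤ n → 1 ≤ k → δ ≤ 2 * k → IsDeltaSeparated δ V → (∀ v ∈ V, #v ≤ k) →
      (#V : ℝ) ≤ C * ((n : ℝ) ^ d * k / (δ : ℝ) ^ (d + 1)) := by
  classical
  obtain ⟨K, hK0, hK⟩ := exists_card_traces_le hd
  obtain ⟨D', hD'⟩ := exists_vcBound hd
  -- `s` is the factor by which the sampling rate exceeds `1 / δ`
  set D : ℝ := (D' : ℝ) + 1 with hDdef
  set s : ℝ := 8 * D with hs
  set A : ℝ := 2 * ((d + 1) ^ d * d.factorial : ℕ) with hA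
  have hD1 : 1 ≤ D := by
    have : (0 : ℝ) ≤ D' := Nat.cast_nonneg _
    linarith
  have hs0 : 0 < s := by positivity
  have hA0 : 0 ≤ A := by positivity
  set C₁ : ℝ := K * (2 * 2 ^ d) * s ^ (d + 1)
  set C₂ : ℝ := 2 * (K * ((4 * s + 2) * (A * (s + 1) ^ d)))
  have hC₁ : 0 ≤ C₁ := by positivity
  have hC₂ : 0 ≤ C₂ := by positivity
  refine ⟨C₁ + C₂ + 1, by positivity, ?_⟩
  intro n p V hV δ k hδ hδn hk hδk hsep hVk
  have hδ' : (1 : ℝ) ≤ δ := by exact_mod_cast hδ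
  have hδn' : (δ : ℝ) ≤ n := by exact_mod_cast hδn
  have hk' : (1 : ℝ) ≤ k := by exact_mod_cast hk
  have hδk' : (δ : ℝ) ≤ 2 * k := by exact_mod_cast hδk
  have hδ0 : (0 : ℝ) < δ := by linarith
  have hn1 : (1 : ℝ) ≤ n := hδ'.trans hδn'
  set Q : ℝ := (n : ℝ) ^ d * k / (δ : ℝ) ^ (d + 1) with hQ
  have hQ0 : 0 ≤ Q := by positivity
  suffices H : (#V : ℝ) ≤ C₁ * Q ∨ (#V : ℝ) ≤ C₂ * Q by
    have e : (C₁ + C₂ + 1) * Q = C₁ * Q + C₂ * Q + Q := by ring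
    have := mul_nonneg hC₁ hQ0
    have := mul_nonneg hC₂ hQ0
    rcases H with H | H <;> linarith
  rcases le_or_gt (δ : ℝ) s with hle | hgt
  · -- small `δ`: all members are distinct traces on the whole set
    left
    have h1 := hK n p V hV univ k
    have h2 : (V.image (· ∩ univ)).filter (fun u => #u ≤ k) = V := by
      simp only [inter_univ, image_id']
      exact filter_true_of_mem hVk
    rw [h2, card_univ, Fintype.card_fin] at h1
    have h3 : ((k : ℝ) + 1) * (n + 1) ^ d ≤ 2 * 2 ^ d * (n ^ d * k) := by
      have e1 : ((n : ℝ) + 1) ^ d ≤ (2 * n) ^ d :=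
        pow_le_pow_left₀ (by positivity) (by linarith) d
      rw [mul_pow] at e1
      calc ((k : ℝ) + 1) * (n + 1) ^ d ≤ (2 * k) * (2 ^ d * n ^ d) := by
            gcongr
            linarith
        _ = _ := by ring
    have h4 : (n : ℝ) ^ d * k ≤ s ^ (d + 1) * Q := by
      rw [hQ, mul_div_assoc', le_div_iff₀ (by positivity), mul_comm]
      gcongr
    calc (#V : ℝ) ≤ K * ((k + 1) * (n + 1) ^ d) := h1
      _ ≤ K * (2 * 2 ^ d * (s ^ (d + 1) * Q)) := by
        refine mul_le_mul_of_nonneg_left (h3.trans ?_) hK0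
        gcongr
      _ = C₁ * Q := by ring
  · -- large `δ`: sample with rate `s / δ`
    right
    set q : ℝ := s / δ with hq
    have hq0 : 0 < q := by positivity
    have hq1 : q ≤ 1 := (div_le_one hδ0).2 hgt.le
    have hVu : ∀ v ∈ V, v ⊆ univ := fun v _ => subset_univ v
    have h1 := separated_sub_sampleMean_le hq0.le hq1 hVu
      (fun v hv v' hv' hne => hsep v hv v' hv' hne) (hD' n p V hV)
    have h2 := sampleMean_card_traces_le hq0 hq1 hk hVu hVk
    set E := sampleMean q univ fun Y => (#(V.image (· ∩ Y)) : ℝ)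
    set E' := sampleMean q univ fun Y =>
      (#((V.image (· ∩ Y)).filter fun u => #u ≤ ⌊4 * q * k⌋₊) : ℝ)
    have hqδ : q * δ = s := div_mul_cancel₀ _ hδ0.ne'
    rw [hqδ] at h1
    have hN0 : (0 : ℝ) ≤ #V := Nat.cast_nonneg _
    have h3 : (#V : ℝ) ≤ 2 * E' := by
      have e1 : 8 * D * (#V - E) ≤ 2 * D * #V := by
        refine h1.trans ?_
        have : (D' : ℝ) ≤ D := by linarith
        gcongr
      have e2 : #V - E ≤ (#V : ℝ) / 4 := by
        refine le_of_mul_le_mul_left ?_ (by positivity : 0 < 8 * D)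
        linarith
      linarith
    have h4 : E' ≤ K * ((4 * q * k + 1) * (A * (q * n + 1) ^ d)) := by
      have e1 : E' ≤ sampleMean q univ fun Y : Finset (Fin n) =>
          (K * (4 * q * k + 1)) * ((#Y : ℝ) + 1) ^ d := by
        refine sampleMean_mono hq0.le hq1 fun Y _ => (hK n p V hV Y _).trans ?_
        rw [← mul_assoc]
        have : (⌊4 * q * k⌋₊ : ℝ) ≤ 4 * q * k := Nat.floor_le (by positivity)
        gcongr
      rw [sampleMean_mul_left] at e1
      refine e1.trans ?_
      have e2 := sampleMean_pow_le hq0.le hq1 (univ : Finset (Fin n)) d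
      rw [card_univ, Fintype.card_fin] at e2
      calc _ ≤ K * (4 * q * k + 1) * (A * (q * n + 1) ^ d) := by gcongr
        _ = _ := by ring
    have h5 : 4 * q * k + 1 ≤ (4 * s + 2) * (k / δ) := by
      have e1 : 1 ≤ 2 * ((k : ℝ) / δ) := by
        rw [mul_div_assoc', le_div_iff₀ hδ0]
        linarith
      have e2 : 4 * q * k = 4 * s * (k / δ) := by
        rw [hq]
        ring
      rw [e2]
      linarith
    have h6 : q * n + 1 ≤ (s + 1) * (n / δ) := by
      have e1 : 1 ≤ (n : ℝ) / δ := (one_le_div hδ0).2 hδn'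
      have e2 : q * n = s * (n / δ) := by
        rw [hq]
        ring
      rw [e2]
      linarith
    calc (#V : ℝ) ≤ 2 * E' := h3
      _ ≤ 2 * (K * ((4 * q * k + 1) * (A * (q * n + 1) ^ d))) := by gcongr
      _ ≤ 2 * (K * (((4 * s + 2) * (k / δ)) * (A * ((s + 1) * (n / δ)) ^ d))) := by gcongr
      _ = C₂ * Q := by
        simp only [C₂, hQ]
        rw [mul_pow, div_pow, pow_succ]
        field_simp

end SlabPacking
end ShallowPacking

theorem mainTheorem4 (d : ℕ) :
    ∃ C : ℝ, 0 < C ∧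
      ∀ (n : ℕ) (p : Fin n → EuclideanSpace ℝ (Fin d)), Function.Injective p →
      ∀ V : Finset (Finset (Fin n)), ShallowPacking.IsSlabSystem p V →
      ∀ δ k : ℕ, 1 ≤ δ → (δ : ℝ) ≤ (n : ℝ) / 2 ^ (V.vcDim + 1) →
        1 ≤ k → k ≤ n → (δ : ℝ) / 2 ≤ (k : ℝ) →
        (ShallowPacking.shallowPackingNumber δ k V : ℝ)
          ≤ C * ((n : ℝ) ^ d * (k : ℝ) / (δ : ℝ) ^ (d + 1)) := by
  classical
  -- it suffices to bound each of the families over which the maximum is taken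
  have hsup : ∀ {n : ℕ} (V : Finset (Finset (Fin n))) (δ k : ℕ),
      ∃ W ⊆ V, (∀ v ∈ W, v.card ≤ k) ∧ ShallowPacking.IsDeltaSeparated δ W ∧
        ShallowPacking.shallowPackingNumber δ k V = W.card := by
    intro n V δ k
    obtain ⟨W, hW, he⟩ := Finset.exists_mem_eq_sup
      ((V.filter fun v => v.card ≤ k).powerset.filter
        fun W => ShallowPacking.IsDeltaSeparated δ W)
      ⟨∅, Finset.mem_filter.2 ⟨by simp, by simp [ShallowPacking.IsDeltaSeparated]⟩⟩ Finset.card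
    obtain ⟨h1, h2⟩ := Finset.mem_filter.1 hW
    have h1 := Finset.mem_powerset.1 h1
    refine ⟨W, fun v hv => (Finset.mem_filter.1 (h1 hv)).1,
      fun v hv => (Finset.mem_filter.1 (h1 hv)).2, h2, ?_⟩
    rw [← he, ShallowPacking.shallowPackingNumber, ShallowPacking.packingNumber]
  rcases Nat.eq_zero_or_pos d with rfl | hd
  · -- there are no slabs in dimension zero
    refine ⟨1, one_pos, fun n p _ V hV δ k _ _ _ _ _ => ?_⟩
    obtain ⟨W, hWV, -, -, he⟩ := hsup V δ k
    have : W = ∅ := Finset.eq_empty_of_forall_notMem fun v hv => by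
      obtain ⟨S, ⟨w, -, -, hw, -⟩, -⟩ := hV v (hWV hv)
      exact hw (Subsingleton.elim _ _)
    rw [he, this, Finset.card_empty, Nat.cast_zero]
    positivity
  · obtain ⟨C, hC, hmain⟩ := ShallowPacking.exists_separated_card_le hd
    refine ⟨C, hC, fun n p _ V hV δ k hδ hδn hk _ hδk => ?_⟩
    obtain ⟨W, hWV, hWk, hWδ, he⟩ := hsup V δ k
    rw [he]
    refine hmain n p W (fun v hv => hV v (hWV hv)) δ k hδ ?_ hk ?_ hWδ hWk
    · have h1 : (n : ℝ) / 2 ^ (V.vcDim + 1) ≤ n :=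
        div_le_self (Nat.cast_nonneg n) (one_le_pow₀ (by norm_num))
      exact_mod_cast hδn.trans h1
    · have : (δ : ℝ) ≤ 2 * k := by linarith
      exact_mod_cast this
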